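/- **Grids.** Let $(X,\mathbb A,\nu)$ be a probability space and write $|A|=\nu(A)$. A *grid* is a sequence $\mathcal P=(\mathcal P^k)_{k\ge 0}$ of finite families of measurable sets of positive measure, at least one of them nonempty, with $\sup_k\sup_{Q\in\mathcal P^k}\#\{R\in\mathcal P^k: R\cap Q\ne\emptyset\}<\infty$. We write $Q\in\mathcal P$ for $Q\in\bigcup_k\mathcal P^k$ and $k_0(\Omega,\mathcal P)=\min\{k: \exists R\in\mathcal P^k,\ R\subset\Omega\}$. For $0<\lambda_1<\lambda_2<1$ the grid is *$(\lambda_1,\lambda_2)$-good* if $\mathcal P^0=\{X\}$; each $\mathcal P^k$ covers $X$ up to a null set and consists of pairwise disjoint sets; every $Q\in\mathcal P^{k+1}$ is contained in some $R\in\mathcal P^{k}$; $\lambda_1\le |Q|/|R|\le\lambda_2$ whenever $Q\in\mathcal P^{k+1}$, $R\in\mathcal P^k$, $Q\subset R$; and $\bigcup_k\mathcal P^k$ generates $\mathbb A$. **Parameters.** Fix real numbers $p\ge1$, $\gamma\in(0,1]$, $s,\beta,\epsilon,\delta>0$ and $q\in[1,\infty]$ with $s+\epsilon\le 1/p$, $s<\beta<1/p$,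 $\delta<\max\{s,\epsilon\}$. Let $t_0=p/(1-sp+\delta p)$ and $1/p+1/p'=1$. **Representations.** For a grid $\mathcal P$ and coefficients $d=(d_Q)$ put $\|d\|_{\mathcal P}=\big(\sum_k(\sum_{Q\in\mathcal P^k}|d_Q|^p)^{q/p}\big)^{1/q}$ (a supremum over $k$ if $q=\infty$). Given functions $b_Q$, an equation $f=\sum_k\sum_{Q\in\mathcal P^k}d_Qb_Q$ is a *representation* of $f\in L^p$ if $\|d\|_{\mathcal P}<\infty$, $\sum_k|\sum_{Q\in\mathcal P^k}d_Qb_Q|_p<\infty$ and the series converges to $f$ in $L^p$. The Souza atom of exponent $s$ is $a_Q=|Q|^{s-1/p}1_Q$. A $\mathcal B^s_{p,q}$-representation is a representation with $b_Q=a_Q$; $\mathcal B^s_{p,q}(X,\nu,\mathcal P)$ is the set of complex functions that have one, with norm the infimum of $\|d\|_{\mathcal P}$. $\mathcal B^s_{p,q}(W)$ and its norm are obtained by using only $Q\in\mathcal P$ with $Q\subset W$ (levels and measure unchanged); $\beta$ in place of $s$ means that $\beta$ is used in the atoms too. **Besov atoms and $C_{GBS}$.** A function $b$ is an $(s,\beta,p,q)$-*Besov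 atom* on $W\in\mathcal P$ if $|b|_{\mathcal B^\beta_{p,q}(W)}\le|W|^{s-\beta}$. It is a *positive* atom if moreover it has a $\mathcal B^\beta_{p,q}(W)$-representation with nonnegative coefficients $c$ and $\|c\|\le |W|^{s-\beta}$. A number $C$ is a *conversion constant* for $(X,\nu,\mathcal P)$ if for every representation $f=\sum d_Qb_Q$, with $b_Q$ a Besov atom on $Q$ for all $Q\in\mathcal P$, there is a $\mathcal B^s_{p,q}$-representation $f=\sum z_Qa_Q$ with $\|z\|_{\mathcal P}\le C\|d\|_{\mathcal P}$, and with $z\ge0$ if $d\ge0$ and all $b_Q$ are positive atoms. **Branches and potentials.** Let $(I,m,\mathcal P)$ and $(J,\mu,\mathcal H)$ be probability spaces with good grids. Let $\Lambda\subset\mathbb N$, and for $r\in\Lambda$ let $I_r\subset I$, $J_r\subset J$ be measurable, $h_r:J_r\to I_r$ a bimeasurable bijection, $g_r:J_r\to\mathbb C$ a function, $\mathcal G_r$ a grid for $m$, $a_r\in\mathbb R$, $|\epsilon_r|=\epsilon$, and let $A_r,\alpha_r,B_r,b_r,R_r$ be positive constants. For sets $Q\in\mathcal G_r$, $Q\subset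 I_r$, write $Q'=h_r^{-1}(Q)$. Assume for every $r\in\Lambda$: * For each $j$ the sets $Q\in\mathcal G_r^j$ with $Q\subset I_r$ are pairwise disjoint and satisfy $k_0(Q,\mathcal G_r)=j$. * For measurable $A\subset I_r$: $m(A)=0$ iff $\mu(h_r^{-1}(A))=0$. Up to null sets, $I_r$ is a countable union of elements of $\mathcal P$, and for every $Q\in\mathcal G_r$, $Q\subset I_r$, the set $Q'$ is a countable union of elements of $\mathcal H$. * For every $Q\in\mathcal G_r$, $Q\subset I_r$, there are $\mathcal F^k\subset\mathcal H^k$, $k\ge k_0:=k_0(Q',\mathcal H)$, such that distinct members of $\bigcup_k\mathcal F^k$ are disjoint, $Q'=\bigcup_{k\ge k_0}\bigcup_{W\in\mathcal F^k}W$, and $\sum_{W\in\mathcal F^k}|W|^{1-sp}\le A_r\alpha_r^{k-k_0}|Q'|^{1-sp}$ for all $k\ge k_0$. * For such $Q$, with $n_Q=|k_0(Q,\mathcal G_r)-k_0(Q',\mathcal H)|$: $n_Q\ge a_r$ and $(|Q|/|Q'|)^{\epsilon_r/|\epsilon_r|}\le B_r b_r^{n_Q}$. * For $W\in\mathcal H$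 and $Q\in\mathcal G_r$ with $W\subset J_r$, $Q\subset I_r$, $h_r(W)\subset Q$: $|g_r1_W|_{\mathcal B^\beta_{p,q}(W)}\le M_r(Q,W):=R_r(|Q|/|Q'|)^{1/p-s+\epsilon_r}|W|^{1/p-\beta}$. * $\tau_r:=\max\{b_r^{\epsilon},\alpha_r^{1/p}\}<1$. Assume also that $\lambda:=\sup_r\tau_r<1$; that the sets $Q\in\mathcal G_r$ with $Q\subset I_r$ for some $r$, together with the sets $Q\in\mathcal P$ disjoint from all $I_r$, generate the $\sigma$-algebra of $I$; and that, with $\Phi_r(f)=g_r\cdot(f\circ h_r)$ on $J_r$ and $0$ elsewhere, there is $K\ge0$ such that for every $f\in L^{t_0}(m)$ each $\Phi_r(f)$ is in $L^1(\mu)$ and $\sum_r|\Phi_r(f)|_{L^1(\mu)}\le K|f|_{L^{t_0}(m)}$. Let $\Phi(f)=\sum_{r\in\Lambda}\Phi_r(f)$, $\Theta_r=B_r^{\epsilon}R_rA_r^{1/p}\tau_r^{a_r(1-\gamma)}$ and $N=\sup_{W\in\mathcal H}\#\{r\in\Lambda:W\subset J_r\}$. The potentials are *positive* if for every $r$ and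 every $W\in\mathcal H$, $W\subset J_r$, the function $g_r1_W$ has a $\mathcal B^\beta_{p,q}(W)$-representation with nonnegative coefficients $c$ such that $\|c\|\le M_r(Q,W)$ for all $Q\in\mathcal G_r$ with $Q\subset I_r$ and $h_r(W)\subset Q$. **Slicing.** A $\mathcal B^s_{p,q}$-representation $f=\sum_{Q\in\mathcal P}d_Qa_Q$ has a *$C$-regular slicing*, $C\ge0$, if for every $r$ there is a representation $f1_{I_r}=\sum_{Q\in\mathcal G_r,\,Q\subset I_r}c^r_Qa_Q$ by Souza atoms of exponent $s$ such that $$\Big(\sum_j\Big(\sum_r\Theta_r\Big(\sum_{Q\in\mathcal G_r^j,\,Q\subset I_r}|c_Q^r|^p\Big)^{1/p}\Big)^q\Big)^{1/q}\le C\|d\|_{\mathcal P}$$ or $$N^{1/p'}\Big(\sum_j\Big(\sum_r\Theta_r^p\sum_{Q\in\mathcal G_r^j,\,Q\subset I_r}|c_Q^r|^p\Big)^{q/p}\Big)^{1/q}\le C\|d\|_{\mathcal P}$$ (usual reading for $q=\infty$; $N^{1/p'}=1$ if $p=1$, even if $N=\infty$), and such that moreover $c^r\ge0$ for every $r$ if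 $d\ge0$. **Theorem.** 1. For all $0<\lambda_1<\lambda_2<1$ there is a number $C_{GBS}>0$, depending only on $s,\beta,p,q,\lambda_1,\lambda_2$, that is a conversion constant for every probability space with a $(\lambda_1,\lambda_2)$-good grid. 2. Let $C_{GBS}$ be any conversion constant for $(J,\mu,\mathcal H)$. If a $\mathcal B^s_{p,q}$-representation $f=\sum_{Q\in\mathcal P}d_Qa_Q$ of a function $f\in\mathcal B^s_{p,q}(I,m,\mathcal P)$ has a $C$-regular slicing, then $\Phi(f)\in\mathcal B^s_{p,q}(J,\mu,\mathcal H)$, and $\Phi(f)$ has a $\mathcal B^s_{p,q}$-representation $\Phi(f)=\sum_{Q\in\mathcal H}z_Qa_Q$ with $$\|z\|_{\mathcal H}\le C_{GBS}\cdot\frac{2}{1-\lambda^{\gamma}}\cdot C\cdot\|d\|_{\mathcal P}.$$ If moreover the potentials are positive and $d_Q\ge0$ for all $Q\in\mathcal P$, then the $z_Q$ can be chosen nonnegative. -/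

import Mathlib

open Set Filter Topology MeasureTheory
open scoped ENNReal ComplexOrder

noncomputable section

namespace BesovTransfer

/-! ## Grids -/

section Grids

variable {X : Type*} [MeasurableSpace X]

/-- A grid on `(X, m)`: a sequence of finite families of measurable sets of positive measure, at
least one of them nonempty, such that each member of a family meets a uniformly bounded number of
members of the same family. -/
structure IsGrid (m : Measure X) (P : ℕ → Finset (Set X)) : Prop where
  measurableSet : ∀ k, ∀ Q ∈ P k, MeasurableSet Q
  measure_pos : ∀ k, ∀ Q ∈ P k, 0 < m Q
  exists_nonempty : ∃ k, (P k).Nonempty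
  multiplicity : ∃ M : ℕ, ∀ k, ∀ Q ∈ P k, {R | R ∈ P k ∧ (R ∩ Q).Nonempty}.ncard ≤ M

/-- An `(l₁, l₂)`-good grid on `(X, m)`. -/
structure IsGoodGrid (m : Measure X) (P : ℕ → Finset (Set X)) (l₁ l₂ : ℝ) : Prop
    extends IsGrid m P where
  const_pos : 0 < l₁
  const_lt : l₁ < l₂
  const_lt_one : l₂ < 1
  level_zero : P 0 = {univ}
  cover : ∀ k, (⋃ Q ∈ P k, Q) =ᵐ[m] (univ : Set X)
  disjoint : ∀ k, ∀ Q ∈ P k, ∀ R ∈ P k, Q ≠ R → Disjoint Q R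
  nested : ∀ k, ∀ Q ∈ P (k + 1), ∃ R ∈ P k, Q ⊆ R
  ratio : ∀ k, ∀ Q ∈ P (k + 1), ∀ R ∈ P k, Q ⊆ R →
    l₁ ≤ m.real Q / m.real R ∧ m.real Q / m.real R ≤ l₂
  generates : MeasurableSpace.generateFrom {Q | ∃ k, Q ∈ P k} = ‹MeasurableSpace X›

/-- The first level at which the grid has a member contained in `Ω`. -/
def firstLevel (Ω : Set X) (P : ℕ → Finset (Set X)) : ℕ :=
  sInf {k | ∃ R ∈ P k, R ⊆ Ω}

open Classical in
/-- The members of the grid that are contained in `Ω`, with their levels unchanged. -/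
def gridWithin (P : ℕ → Finset (Set X)) (Ω : Set X) : ℕ → Finset (Set X) :=
  fun k => (P k).filter (fun R => R ⊆ Ω)

/-! ## Representations by atoms, Besov spaces -/

/-- Souza's canonical `(s, p)`-atom on `Q`. -/
def souzaAtom (m : Measure X) (p s : ℝ) (Q : Set X) : X → ℂ :=
  Q.indicator (fun _ => ((m.real Q ^ (s - 1 / p) : ℝ) : ℂ))

/-- `(∑_k (∑_{Q ∈ P^k} |d_Q|^p)^{q/p})^{1/q}`, the supremum over `k` of the inner `ℓ^p` norms when
`q = ∞`: the `ℓ^q` norm of the sequence of the `ℓ^p` norms. -/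
def coefNorm (p : ℝ) (q : ℝ≥0∞) (P : ℕ → Finset (Set X)) (d : Set X → ℂ) : ℝ≥0∞ :=
  eLpNorm (fun k : ℕ => (∑ Q ∈ P k, ‖d Q‖ₑ ^ p) ^ (1 / p)) q Measure.count

/-- All coefficients are nonnegative real numbers. -/
def NonnegCoef (P : ℕ → Finset (Set X)) (d : Set X → ℂ) : Prop :=
  ∀ k, ∀ Q ∈ P k, 0 ≤ d Q

/-- `f = ∑_k ∑_{Q ∈ P^k} d_Q b_Q`, with absolute convergence in `L^p` and finite coefficient
norm. -/
structure IsAtomicRep (m : Measure X) (p : ℝ) (q : ℝ≥0∞) (P : ℕ → Finset (Set X))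
    (b : Set X → X → ℂ) (f : X → ℂ) (d : Set X → ℂ) : Prop where
  memLp : MemLp f (ENNReal.ofReal p) m
  coefNorm_lt_top : coefNorm p q P d < ∞
  abs_convergent :
    ∑' k, eLpNorm (fun x => ∑ Q ∈ P k, d Q * b Q x) (ENNReal.ofReal p) m < ∞
  tendsto : Tendsto
    (fun n => eLpNorm (fun x => f x - ∑ k ∈ Finset.range n, ∑ Q ∈ P k, d Q * b Q x)
      (ENNReal.ofReal p) m) atTop (𝓝 0)

/-- `∑_k ∑_{Q ∈ P^k} d_Q a_Q` is a `B^s_{p,q}`-representation of `f`. -/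
def IsSouzaRep (m : Measure X) (p : ℝ) (q : ℝ≥0∞) (P : ℕ → Finset (Set X)) (s : ℝ)
    (f : X → ℂ) (d : Set X → ℂ) : Prop :=
  IsAtomicRep m p q P (souzaAtom m p s) f d

/-- `f ∈ B^s_{p,q}(X, m, P)`. -/
def MemBesov (m : Measure X) (p : ℝ) (q : ℝ≥0∞) (P : ℕ → Finset (Set X)) (s : ℝ)
    (f : X → ℂ) : Prop :=
  ∃ d, IsSouzaRep m p q P s f d

/-- The `B^s_{p,q}(X, m, P)`-norm; it is `∞` if `f` has no representation. The norm of
`B^s_{p,q}(W)`, where only sets contained in `W` are used, is obtained by taking `gridWithin P W`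
for `P`. -/
def besovNorm (m : Measure X) (p : ℝ) (q : ℝ≥0∞) (P : ℕ → Finset (Set X)) (s : ℝ)
    (f : X → ℂ) : ℝ≥0∞ :=
  ⨅ (d : Set X → ℂ) (_ : IsSouzaRep m p q P s f d), coefNorm p q P d

/-- `b` is an `(s, β, p, q)`-Besov atom supported on `W`. -/
def IsBesovAtom (m : Measure X) (p : ℝ) (q : ℝ≥0∞) (P : ℕ → Finset (Set X)) (s β : ℝ)
    (W : Set X) (b : X → ℂ) : Prop :=
  besovNorm m p q (gridWithin P W) β b ≤ ENNReal.ofReal (m.real W ^ (s - β))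

/-- `b` is an `(s, β, p, q)`-Besov positive atom supported on `W`. -/
def IsPositiveBesovAtom (m : Measure X) (p : ℝ) (q : ℝ≥0∞) (P : ℕ → Finset (Set X)) (s β : ℝ)
    (W : Set X) (b : X → ℂ) : Prop :=
  IsBesovAtom m p q P s β W b ∧
  ∃ c, IsSouzaRep m p q (gridWithin P W) β b c ∧ NonnegCoef (gridWithin P W) c ∧
    coefNorm p q (gridWithin P W) c ≤ ENNReal.ofReal (m.real W ^ (s - β))

/-- `C` is a constant for the conversion of representations by Besov atoms into representations by
Souza atoms: every series `∑ d_Q b_Q` of Besov atoms with finite coefficient norm can be rewritten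
as a series `∑ z_Q a_Q` of Souza atoms whose coefficient norm is at most `C` times larger, with
`z ≥ 0` if `d ≥ 0` and all the `b_Q` are positive atoms. -/
def IsBesovToSouzaConst (m : Measure X) (p : ℝ) (q : ℝ≥0∞) (P : ℕ → Finset (Set X)) (s β : ℝ)
    (C : ℝ) : Prop :=
  ∀ (f : X → ℂ) (b : Set X → X → ℂ) (d : Set X → ℂ),
    (∀ k, ∀ Q ∈ P k, IsBesovAtom m p q P s β Q (b Q)) →
    IsAtomicRep m p q P b f d →
    ∃ z, IsSouzaRep m p q P s f z ∧
      coefNorm p q P z ≤ ENNReal.ofReal C * coefNorm p q P d ∧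
      (NonnegCoef P d → (∀ k, ∀ Q ∈ P k, IsPositiveBesovAtom m p q P s β Q (b Q)) →
        NonnegCoef P z)

/-- `Ω` is an `(α, C, l)`-regular domain. -/
def IsRegularDomain (m : Measure X) (P : ℕ → Finset (Set X)) (α C l : ℝ) (Ω : Set X) : Prop :=
  ∃ F : ℕ → Finset (Set X),
    (∀ k, F k ⊆ P k) ∧
    Ω = ⋃ k ≥ firstLevel Ω P, ⋃ Q ∈ F k, Q ∧
    (∀ i ≥ firstLevel Ω P, ∀ j ≥ firstLevel Ω P, ∀ Q ∈ F i, ∀ R ∈ F j, Q ≠ R → Disjoint Q R) ∧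
    ∀ k ≥ firstLevel Ω P,
      ∑ Q ∈ F k, m.real Q ^ α ≤ C * l ^ (k - firstLevel Ω P) * m.real Ω ^ α

/-- Up to a null set, `A` is a countable union of members of the grid. -/
def IsUnionOfGrid (m : Measure X) (P : ℕ → Finset (Set X)) (A : Set X) : Prop :=
  ∃ S : Set (Set X), S.Countable ∧ (∀ Q ∈ S, ∃ k, Q ∈ P k) ∧ A =ᵐ[m] ⋃₀ S

end Grids

/-! ## Branches and potentials -/

section Branches

variable {I J : Type*} [MeasurableSpace I] [MeasurableSpace J]

/-- `h⁻¹(Q)`, as a subset of the ambient space `J`, for `h : J' → I'`, `J' ⊆ J`, `I' ⊆ I`. -/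
def pullback {J' : Set J} {I' : Set I} (h : J' ≃ᵐ I') (Q : Set I) : Set J :=
  {y | ∃ hy : y ∈ J', (h ⟨y, hy⟩ : I) ∈ Q}

/-- The local grid of a branch with image `I'`: a grid whose members contained in `I'` are pairwise
disjoint within each level and have `firstLevel` equal to their own level. -/
structure IsLocalGrid (m : Measure I) (G : ℕ → Finset (Set I)) (I' : Set I) : Prop
    extends IsGrid m G where
  disjoint : ∀ k, ∀ Q ∈ G k, ∀ R ∈ G k, Q ⊆ I' → R ⊆ I' → Q ≠ R → Disjoint Q R
  firstLevel_eq : ∀ k, ∀ Q ∈ G k, Q ⊆ I' → firstLevel Q G = k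

/-- `h : J' → I'` is an `(s, p, a, e, cD, lD, cS, lS, G)`-branch. -/
structure IsBranch (m : Measure I) (P : ℕ → Finset (Set I)) (μ : Measure J)
    (H : ℕ → Finset (Set J)) (s p a e cD lD cS lS : ℝ) (G : ℕ → Finset (Set I))
    {J' : Set J} {I' : Set I} (h : J' ≃ᵐ I') : Prop where
  measurableSet_dom : MeasurableSet J'
  measurableSet_im : MeasurableSet I'
  localGrid : IsLocalGrid m G I'
  nonsingular : ∀ Q ⊆ I', MeasurableSet Q → (m Q = 0 ↔ μ (pullback h Q) = 0)
  geometric : ∀ k, ∀ Q ∈ G k, Q ⊆ I' → IsRegularDomain μ H (1 - s * p) cD lD (pullback h Q)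
  scaling_level : ∀ k, ∀ Q ∈ G k, Q ⊆ I' →
    a ≤ |(firstLevel Q G : ℝ) - firstLevel (pullback h Q) H|
  scaling_size : ∀ k, ∀ Q ∈ G k, Q ⊆ I' →
    (m.real Q / μ.real (pullback h Q)) ^ (e / |e|) ≤
      cS * lS ^ |(firstLevel Q G : ℝ) - firstLevel (pullback h Q) H|
  im_union : IsUnionOfGrid m P I'
  pullback_union : ∀ k, ∀ Q ∈ G k, Q ⊆ I' → IsUnionOfGrid μ H (pullback h Q)

/-- The bound `cR (|Q| / |h⁻¹ Q|)^{1/p - s + e} |W|^{1/p - β}`. -/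
def potentialBound (m : Measure I) (μ : Measure J) (s p β e cR : ℝ)
    {J' : Set J} {I' : Set I} (h : J' ≃ᵐ I') (Q : Set I) (W : Set J) : ℝ :=
  cR * (m.real Q / μ.real (pullback h Q)) ^ (1 / p - s + e) * μ.real W ^ (1 / p - β)

/-- `g · 1_W`, where `g` is extended by zero outside its domain. -/
def potentialOn {J' : Set J} (g : J' → ℂ) (W : Set J) : J → ℂ :=
  W.indicator (Function.extend Subtype.val g 0)

/-- `g` is a `(cR, β, e)`-regular potential associated to `h`. The condition `W ⊆ pullback h Q`
says that `W` is contained in the domain of `h` and `h(W) ⊆ Q`. -/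
def IsRegularPotential (m : Measure I) (μ : Measure J) (H : ℕ → Finset (Set J))
    (s p : ℝ) (q : ℝ≥0∞) (β e cR : ℝ) (G : ℕ → Finset (Set I))
    {J' : Set J} {I' : Set I} (h : J' ≃ᵐ I') (g : J' → ℂ) : Prop :=
  ∀ i, ∀ W ∈ H i, ∀ j, ∀ Q ∈ G j, Q ⊆ I' → W ⊆ pullback h Q →
    besovNorm μ p q (gridWithin H W) β (potentialOn g W) ≤
      ENNReal.ofReal (potentialBound m μ s p β e cR h Q W)

/-- `g` is a positive regular potential. -/
def IsPositivePotential (m : Measure I) (μ : Measure J) (H : ℕ → Finset (Set J))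
    (s p : ℝ) (q : ℝ≥0∞) (β e cR : ℝ) (G : ℕ → Finset (Set I))
    {J' : Set J} {I' : Set I} (h : J' ≃ᵐ I') (g : J' → ℂ) : Prop :=
  ∀ i, ∀ W ∈ H i, W ⊆ J' →
    ∃ c, IsSouzaRep μ p q (gridWithin H W) β (potentialOn g W) c ∧
      NonnegCoef (gridWithin H W) c ∧
      ∀ j, ∀ Q ∈ G j, Q ⊆ I' → W ⊆ pullback h Q →
        coefNorm p q (gridWithin H W) c ≤
          ENNReal.ofReal (potentialBound m μ s p β e cR h Q W)

end Branches

/-! ## Transfer transformations -/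

/-- The data of a transfer transformation: branches `h_r : J_r → I_r`, potentials `g_r`, local grids
`G_r` and the constants attached to them. -/
structure TransferData (I J : Type*) [MeasurableSpace I] [MeasurableSpace J] where
  /-- the index set -/
  Λ : Set ℕ
  /-- the domains `J_r` of the branches -/
  dom : Λ → Set J
  /-- the images `I_r` of the branches -/
  im : Λ → Set I
  /-- the branches `h_r` -/
  h : ∀ r, dom r ≃ᵐ im r
  /-- the potentials `g_r` -/
  g : ∀ r, dom r → ℂ
  /-- the local grids `G_r` -/
  G : Λ → ℕ → Finset (Set I)
  /-- the level gaps `a_r` -/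
  a : Λ → ℝ
  /-- the signed exponents `ε_r` -/
  e : Λ → ℝ
  /-- multiplicative constants of the geometric distortion control -/
  cD : Λ → ℝ
  /-- rates of the geometric distortion control -/
  lD : Λ → ℝ
  /-- multiplicative constants of the scaling control -/
  cS : Λ → ℝ
  /-- rates of the scaling control -/
  lS : Λ → ℝ
  /-- constants of the potentials -/
  cR : Λ → ℝ

namespace TransferData

variable {I J : Type*} [MeasurableSpace I] [MeasurableSpace J] (D : TransferData I J)

/-- `max {lS_r ^ ε, lD_r ^ (1/p)}`. -/
def rate (p ε : ℝ) (r : D.Λ) : ℝ :=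
  max (D.lS r ^ ε) (D.lD r ^ (1 / p))

/-- The supremum of the rates. -/
def supRate (p ε : ℝ) : ℝ :=
  ⨆ r, D.rate p ε r

/-- The regularity `Θ_r` of the pair `(h_r, g_r)`. -/
def Θ (p ε γ : ℝ) (r : D.Λ) : ℝ :=
  D.cS r ^ ε * D.cR r * D.cD r ^ (1 / p) * D.rate p ε r ^ (D.a r * (1 - γ))

open Classical in
/-- `Φ_r(f) = g_r · (f ∘ h_r)`, extended by zero outside `J_r`. -/
def branchOp (r : D.Λ) (f : I → ℂ) : J → ℂ :=
  fun y => if hy : y ∈ D.dom r then D.g r ⟨y, hy⟩ * f (D.h r ⟨y, hy⟩) else 0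

/-- The transfer transformation `Φ(f) = ∑_r g_r · (f ∘ h_r)`. -/
def transfer (f : I → ℂ) : J → ℂ :=
  fun y => ∑' r, D.branchOp r f y

/-- The largest number of domains `J_r` that contain a common member of the grid `H`. -/
def overlap (H : ℕ → Finset (Set J)) : ℕ∞ :=
  ⨆ k, ⨆ W ∈ H k, {r : D.Λ | W ⊆ D.dom r}.encard

/-- The standing assumptions on a transfer transformation. -/
structure IsAdmissible (m : Measure I) (P : ℕ → Finset (Set I)) (μ : Measure J)
    (H : ℕ → Finset (Set J)) (p s : ℝ) (q : ℝ≥0∞) (β ε δ : ℝ) : Prop where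
  const_pos : ∀ r, 0 < D.cD r ∧ 0 < D.lD r ∧ 0 < D.cS r ∧ 0 < D.lS r ∧ 0 < D.cR r
  abs_e : ∀ r, |D.e r| = ε
  branch : ∀ r, IsBranch m P μ H s p (D.a r) (D.e r) (D.cD r) (D.lD r) (D.cS r) (D.lS r)
    (D.G r) (D.h r)
  generates : MeasurableSpace.generateFrom
      ({Q | ∃ r k, Q ∈ D.G r k ∧ Q ⊆ D.im r} ∪
        {Q | (∃ k, Q ∈ P k) ∧ ∀ r, Q ∩ D.im r = ∅}) = ‹MeasurableSpace I›
  potential : ∀ r, IsRegularPotential m μ H s p q β (D.e r) (D.cR r) (D.G r) (D.h r) (D.g r)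
  rate_lt_one : ∀ r, D.rate p ε r < 1
  supRate_lt_one : D.supRate p ε < 1
  /-- `∑_r |Φ_r(f)|_{L¹} ≤ K |f|_{L^{t₀}}`, where `t₀ = p / (1 - s p + δ p)`. -/
  bounded : ∃ K : ℝ, 0 ≤ K ∧ ∀ f : I → ℂ,
    MemLp f (ENNReal.ofReal (p / (1 - s * p + δ * p))) m →
      (∀ r, MemLp (D.branchOp r f) 1 μ) ∧
      ∑' r, eLpNorm (D.branchOp r f) 1 μ ≤
        ENNReal.ofReal K * eLpNorm f (ENNReal.ofReal (p / (1 - s * p + δ * p))) m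

/-- The potentials `g_r` are positive. -/
def HasPositivePotentials (m : Measure I) (μ : Measure J) (H : ℕ → Finset (Set J))
    (p s : ℝ) (q : ℝ≥0∞) (β : ℝ) : Prop :=
  ∀ r, IsPositivePotential m μ H s p q β (D.e r) (D.cR r) (D.G r) (D.h r) (D.g r)

/-- The first alternative in the definition of a slicing:
`(∑_j (∑_r Θ_r (∑_Q |c_Q^r|^p)^{1/p})^q)^{1/q}`, with `Q` in `G_r^j`, `Q ⊆ I_r`. -/
def slicingNorm₁ (p : ℝ) (q : ℝ≥0∞) (ε γ : ℝ) (c : D.Λ → Set I → ℂ) : ℝ≥0∞ :=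
  eLpNorm (fun j : ℕ => ∑' r, ENNReal.ofReal (D.Θ p ε γ r) *
    (∑ Q ∈ gridWithin (D.G r) (D.im r) j, ‖c r Q‖ₑ ^ p) ^ (1 / p)) q Measure.count

/-- The second alternative in the definition of a slicing:
`N^{1/p'} (∑_j (∑_r Θ_r^p ∑_Q |c_Q^r|^p)^{q/p})^{1/q}`, with `Q` in `G_r^j`, `Q ⊆ I_r`, and
`1/p' = 1 - 1/p`; note `N^0 = 1` even if `N = ∞`. -/
def slicingNorm₂ (H : ℕ → Finset (Set J)) (p : ℝ) (q : ℝ≥0∞) (ε γ : ℝ)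
    (c : D.Λ → Set I → ℂ) : ℝ≥0∞ :=
  (D.overlap H : ℝ≥0∞) ^ (1 - 1 / p) *
  eLpNorm (fun j : ℕ => (∑' r, ENNReal.ofReal (D.Θ p ε γ r) ^ p *
    ∑ Q ∈ gridWithin (D.G r) (D.im r) j, ‖c r Q‖ₑ ^ p) ^ (1 / p)) q Measure.count

/-- The pair formed by the weighted family of branches and the representation `∑ d_Q a_Q` of `f`
has a `C`-regular slicing. -/
def HasRegularSlicing (m : Measure I) (P : ℕ → Finset (Set I)) (H : ℕ → Finset (Set J))
    (p s : ℝ) (q : ℝ≥0∞) (ε γ : ℝ) (f : I → ℂ) (d : Set I → ℂ) (C : ℝ) : Prop :=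
  0 ≤ C ∧ IsSouzaRep m p q P s f d ∧
  ∃ c : D.Λ → Set I → ℂ,
    (∀ r, IsSouzaRep m p q (gridWithin (D.G r) (D.im r)) s ((D.im r).indicator f) (c r)) ∧
    (D.slicingNorm₁ p q ε γ c ≤ ENNReal.ofReal C * coefNorm p q P d ∨
      D.slicingNorm₂ H p q ε γ c ≤ ENNReal.ofReal C * coefNorm p q P d) ∧
    (NonnegCoef P d → ∀ r, NonnegCoef (gridWithin (D.G r) (D.im r)) (c r))

end TransferData

end BesovTransfer

end

open BesovTransfer

universe u v

/-! Both statements come down to estimating matrices acting on coefficients whose entries between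
levels k and j decay like x^|k-j| with x < 1. Young's inequality `eLpNorm_count_conv_le` then gives
the factor 2/(1-x).

Conversion of Besov atoms. An atom on Q is a series of Souza atoms of exponent β on sets R ⊆ Q.
Changing β to s multiplies the coefficient of R by |R|^{β-s}. In a good grid |R| ≤ l₂^{j-k}|Q|, so
this factor supplies the decay l₂^{(β-s)(j-k)}, and the remaining |Q|^{β-s} cancels the
normalisation |Q|^{s-β} of the atom. Each R lies in at most one Q of a given level, so ℓ^p norms are
not inflated (`lpSum_changeExponent_le`, `isBesovToSouzaConst`).

Transfer. On I_r write f = ∑ c_Q a_Q. The function a_Q ∘ h_r is the constant |Q|^{s-1/p} on Q', and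
Q' splits into disjoint members W of the grid of J. The hypothesis on g_r makes |Q|^{s-1/p} g_r 1_W
a Besov atom times the weight R_r (|Q|/|Q'|)^{ε_r} (|W|/|Q'|)^{1/p-s} (`weight_identity`).
Regularity of Q' and the scaling control bound the ℓ^p norm of these weights over the W of level k
by B_r^ε R_r A_r^{1/p} τ_r^t, where t = n_Q + k - k₀(Q'). Since t ≥ |k-j| and t ≥ a_r, the share γ
of the exponent yields λ^{γ|k-j|} and the share 1-γ completes Θ_r (`IsBranch.scaling_le`). Branches
are summed by Minkowski's inequality or by a power mean with overlap N, according to the slicing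
alternative, and levels by Young.

All contributions falling on one W are finally merged: their sum divided by the total weight
`totalCoef` is again a Besov atom on W (`isBesovAtom_blockAtom`). Thus Φ(f) is a series of Besov
atoms (`isAtomicRep_transfer`), and the conversion constant finishes the proof. Almost everywhere
absolute convergence justifies the rearrangements, and each construction preserves positivity. -/

noncomputable section

namespace BesovTransfer

/-! ## `ℓ^p` sums and `L^p` norms of `ℝ≥0∞`-valued functions -/

section Minkowski

variable {X : Type*} {mX : MeasurableSpace X} {m : Measure X}

/-- Countable Minkowski inequality. -/
theorem eLpNorm_tsum_le_ennreal {ι : Type*} [Countable ι] {u : ι → X → ℝ≥0∞}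
    (hu : ∀ i, AEMeasurable (u i) m) {p : ℝ≥0∞} (hp : 1 ≤ p) :
    eLpNorm (fun x => ∑' i, u i x) p m ≤ ∑' i, eLpNorm (u i) p m := by
  have hp0 : p ≠ 0 := (zero_lt_one.trans_le hp).ne'
  rcases eq_or_ne p ∞ with rfl | htop
  · simp only [eLpNorm_exponent_top]
    refine essSup_le_of_ae_le _ ?_
    have h : ∀ᵐ x ∂m, ∀ i, ‖u i x‖ₑ ≤ eLpNormEssSup (u i) m :=
      ae_all_iff.2 fun i => ae_le_eLpNormEssSup
    filter_upwards [h] with x hx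
    exact ENNReal.tsum_le_tsum hx
  · have hr : 0 < p.toReal := ENNReal.toReal_pos hp0 htop
    have hfin : ∀ s : Finset ι,
        eLpNorm (fun x => ∑ i ∈ s, u i x) p m ≤ ∑' i, eLpNorm (u i) p m := by
      intro s
      have h := eLpNorm_sum_le (s := s) (f := u) (fun i _ => (hu i).aestronglyMeasurable) hp
      have h2 : (∑ i ∈ s, u i) = fun x => ∑ i ∈ s, u i x := by
        ext x
        simp
      rw [h2] at h
      exact h.trans (ENNReal.sum_le_tsum s)
    simp only [eLpNorm_eq_lintegral_rpow_enorm_toReal hp0 htop (f := fun x => ∑' i, u i x),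
      enorm_eq_self]
    rw [one_div, ENNReal.rpow_inv_le_iff hr]
    -- The finite partial sums form a countable directed family, so monotone convergence carries the
    -- finite inequality to the full sum.
    have hsup : ∀ x, (∑' i, u i x) ^ p.toReal = ⨆ s : Finset ι, (∑ i ∈ s, u i x) ^ p.toReal := by
      intro x
      rw [ENNReal.tsum_eq_iSup_sum]
      exact (ENNReal.orderIsoRpow p.toReal hr).map_iSup _
    simp only [hsup]
    rw [lintegral_iSup_directed
      (fun s => (Finset.aemeasurable_fun_sum s fun i _ => hu i).pow_const _)]
    · refine iSup_le fun s => ?_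
      have h := hfin s
      rw [eLpNorm_eq_lintegral_rpow_enorm_toReal hp0 htop, one_div,
        ENNReal.rpow_inv_le_iff hr] at h
      exact h
    · classical
      refine directed_of_isDirected_le fun s t hst x => ?_
      exact ENNReal.rpow_le_rpow (Finset.sum_le_sum_of_subset hst) hr.le

theorem eLpNorm_const_mul_ennreal (c : ℝ≥0∞) (u : X → ℝ≥0∞) (hu : AEMeasurable u m)
    {p : ℝ≥0∞} (hp : 1 ≤ p) :
    eLpNorm (fun x => c * u x) p m = c * eLpNorm u p m := by
  have hp0 : p ≠ 0 := (zero_lt_one.trans_le hp).ne'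
  rcases eq_or_ne p ∞ with rfl | htop
  · simp only [eLpNorm_exponent_top, eLpNormEssSup, enorm_eq_self]
    exact ENNReal.essSup_const_mul
  · have hr : 0 < p.toReal := ENNReal.toReal_pos hp0 htop
    simp only [eLpNorm_eq_lintegral_rpow_enorm_toReal hp0 htop, enorm_eq_self]
    simp only [ENNReal.mul_rpow_of_nonneg _ _ hr.le]
    rw [lintegral_const_mul'' _ (hu.pow_const _), ENNReal.mul_rpow_of_nonneg _ _ (by positivity),
      ← ENNReal.rpow_mul, mul_one_div_cancel hr.ne', ENNReal.rpow_one]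

end Minkowski

/-- The finite `ℓ^p` norm of an `ℝ≥0∞`-valued family. -/
def lpSum {ι : Type*} (p : ℝ) (s : Finset ι) (x : ι → ℝ≥0∞) : ℝ≥0∞ :=
  (∑ i ∈ s, x i ^ p) ^ (1 / p)

section LpSum

variable {ι κ : Type*} {p : ℝ}

theorem lpSum_rpow (hp : 1 ≤ p) (s : Finset ι) (x : ι → ℝ≥0∞) :
    lpSum p s x ^ p = ∑ i ∈ s, x i ^ p := by
  rw [lpSum, ← ENNReal.rpow_mul, one_div_mul_cancel (by linarith), ENNReal.rpow_one]

theorem lpSum_le_iff (hp : 1 ≤ p) (s : Finset ι) (x : ι → ℝ≥0∞) (M : ℝ≥0∞) :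
    lpSum p s x ≤ M ↔ ∑ i ∈ s, x i ^ p ≤ M ^ p := by
  rw [← lpSum_rpow hp, ENNReal.rpow_le_rpow_iff (by linarith)]

theorem lpSum_mono (hp : 1 ≤ p) {s : Finset ι} {x y : ι → ℝ≥0∞} (h : ∀ i ∈ s, x i ≤ y i) :
    lpSum p s x ≤ lpSum p s y := by
  rw [lpSum_le_iff hp, lpSum_rpow hp]
  exact Finset.sum_le_sum fun i hi => ENNReal.rpow_le_rpow (h i hi) (by linarith)

theorem le_lpSum (hp : 1 ≤ p) {s : Finset ι} (x : ι → ℝ≥0∞) {i : ι} (hi : i ∈ s) :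
    x i ≤ lpSum p s x := by
  rw [← ENNReal.rpow_le_rpow_iff (z := p) (by linarith), lpSum_rpow hp]
  exact Finset.single_le_sum (f := fun i => x i ^ p) (fun _ _ => zero_le) hi

theorem lpSum_const_mul (hp : 1 ≤ p) (s : Finset ι) (c : ℝ≥0∞) (x : ι → ℝ≥0∞) :
    lpSum p s (fun i => c * x i) = c * lpSum p s x := by
  have hp0 : 0 < p := by linarith
  simp only [lpSum, ENNReal.mul_rpow_of_nonneg _ _ hp0.le, ← Finset.mul_sum]
  rw [ENNReal.mul_rpow_of_nonneg _ _ (by positivity), ← ENNReal.rpow_mul,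
    mul_one_div_cancel hp0.ne', ENNReal.rpow_one]

/-- Viewing the finite ℓ^p norm as an L^p norm for counting measure makes the Minkowski inequality
above available for coefficients. -/
theorem lpSum_eq_eLpNorm (hp : 1 ≤ p) (s : Finset ι) (x : ι → ℝ≥0∞) :
    letI : MeasurableSpace s := ⊤
    lpSum p s x = eLpNorm (fun i : s => x i) (ENNReal.ofReal p) Measure.count := by
  let _ : MeasurableSpace s := ⊤
  have hp0 : 0 < p := by linarith
  rw [eLpNorm_eq_lintegral_rpow_enorm_toReal (by simpa using hp0) ENNReal.ofReal_ne_top,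
    ENNReal.toReal_ofReal hp0.le]
  simp only [enorm_eq_self, lintegral_count, tsum_fintype, lpSum]
  rw [← Finset.sum_coe_sort s (fun i => x i ^ p)]

theorem lpSum_tsum_le (hp : 1 ≤ p) [Countable κ] (s : Finset ι) (x : κ → ι → ℝ≥0∞) :
    lpSum p s (fun i => ∑' k, x k i) ≤ ∑' k, lpSum p s (x k) := by
  let _ : MeasurableSpace s := ⊤
  simp only [lpSum_eq_eLpNorm hp]
  exact eLpNorm_tsum_le_ennreal (u := fun k (i : s) => x k i)
    (fun k => measurable_from_top.aemeasurable) (by simpa using hp)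

/-- If each `i` is related to at most one `k`, the `ℓ^p` norm of `i ↦ ∑_k [rel] a_k w_{k,i}` is at
most the `ℓ^p` norm of `a`, times a bound for the `ℓ^p` norms of the `w_k`. -/
theorem lpSum_sum_le_of_unique (hp : 1 ≤ p) (s : Finset ι) (t : Finset κ)
    (rel : κ → ι → Prop) [∀ k i, Decidable (rel k i)]
    (huniq : ∀ i ∈ s, ∀ k ∈ t, ∀ k' ∈ t, rel k i → rel k' i → k = k')
    (a : κ → ℝ≥0∞) (w : κ → ι → ℝ≥0∞) (M : ℝ≥0∞)
    (hw : ∀ k ∈ t, lpSum p s (fun i => if rel k i then w k i else 0) ≤ M) :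
    lpSum p s (fun i => ∑ k ∈ t, if rel k i then a k * w k i else 0) ≤ M * lpSum p t a := by
  have hp0 : 0 < p := by linarith
  rw [lpSum_le_iff hp, ENNReal.mul_rpow_of_nonneg _ _ hp0.le, lpSum_rpow hp]
  -- For fixed i at most one k contributes, so the p-th power passes inside the sum without loss.
  have key : ∀ i ∈ s, (∑ k ∈ t, if rel k i then a k * w k i else 0) ^ p =
      ∑ k ∈ t, a k ^ p * (if rel k i then w k i else 0) ^ p := by
    intro i hi
    by_cases h : ∃ k ∈ t, rel k i
    · obtain ⟨k, hk, hr⟩ := h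
      have hne : ∀ k' ∈ t, k' ≠ k → ¬ rel k' i :=
        fun k' hk' hkk h' => hkk (huniq i hi k' hk' k hk h' hr)
      rw [Finset.sum_eq_single k (fun k' hk' hkk => by simp [hne k' hk' hkk])
          (fun h => absurd hk h),
        Finset.sum_eq_single k
          (fun k' hk' hkk => by simp [hne k' hk' hkk, hp0]) (fun h => absurd hk h)]
      simp [hr, ENNReal.mul_rpow_of_nonneg _ _ hp0.le]
    · push Not at h
      rw [Finset.sum_eq_zero (fun k hk => by simp [h k hk]),
        Finset.sum_eq_zero (fun k hk => by simp [h k hk, hp0])]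
      simp [hp0]
  rw [Finset.sum_congr rfl key, Finset.sum_comm, Finset.mul_sum]
  refine Finset.sum_le_sum fun k hk => ?_
  rw [← Finset.mul_sum, mul_comm (M ^ p)]
  exact mul_le_mul_right ((lpSum_le_iff hp _ _ _).1 (hw k hk)) _

/-- The power mean inequality for a family with at most `N` nonzero terms. -/
theorem tsum_rpow_le_of_encard_le (hp : 1 ≤ p) (x : ι → ℝ≥0∞) {N : ℕ∞}
    (hN : {i | x i ≠ 0}.encard ≤ N) :
    (∑' i, x i) ^ p ≤ (N : ℝ≥0∞) ^ (p - 1) * ∑' i, x i ^ p := by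
  have hp0 : 0 < p := by linarith
  rcases hp.eq_or_lt with rfl | hp1
  · simp
  by_cases hfin : {i | x i ≠ 0}.Finite
  · have h1 : ∑' i, x i = ∑ i ∈ hfin.toFinset, x i :=
      tsum_eq_sum fun i hi => by simpa using hi
    have h2 : ∑' i, x i ^ p = ∑ i ∈ hfin.toFinset, x i ^ p :=
      tsum_eq_sum fun i hi => by
        have : x i = 0 := by simpa using hi
        simp [this, hp0]
    rw [h1, h2]
    refine (ENNReal.rpow_sum_le_const_mul_sum_rpow hfin.toFinset x hp).trans ?_
    gcongr
    rw [hfin.encard_eq_coe_toFinset_card] at hN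
    have := ENat.toENNReal_le.2 hN
    simpa using this
  -- With infinitely many nonzero terms the right-hand side is infinite, because N = ∞, p - 1 > 0
  -- and the sum of powers is nonzero. The case p = 1, where N^0 = 1, had to be settled before.
  · have hNt : N = ⊤ := by
      rw [Set.encard_eq_top_iff.2 hfin] at hN
      exact top_le_iff.1 hN
    have hne : ∑' i, x i ^ p ≠ 0 := by
      intro h0
      apply hfin
      have : {i | x i ≠ 0} = ∅ := by
        ext i
        simpa [hp0, hp0.not_gt] using ENNReal.tsum_eq_zero.1 h0 i
      rw [this]
      exact Set.finite_empty
    rw [hNt, ENat.toENNReal_top, ENNReal.top_rpow_of_pos (by linarith), ENNReal.top_mul hne]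
    exact le_top

end LpSum

/-! ## Convolution with a two-sided geometric sequence -/

section Convolution

/-- A translation of ℕ is injective, so it pushes counting measure to a measure dominated by
counting measure. -/
theorem eLpNorm_count_comp_add_le (u : ℕ → ℝ≥0∞) (i : ℕ) (q : ℝ≥0∞) :
    eLpNorm (fun k => u (k + i)) q Measure.count ≤ eLpNorm u q Measure.count := by
  have hinj : Function.Injective (fun k : ℕ => k + i) := add_left_injective i
  have h := eLpNorm_map_measure (p := q) (μ := (Measure.count : Measure ℕ))
    (f := fun k : ℕ => k + i) (g := u)
    (measurable_from_top.aestronglyMeasurable) measurable_from_top.aemeasurable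
  have h2 : (Measure.count : Measure ℕ).map (fun k => k + i) ≤ Measure.count := by
    rw [Measure.le_iff]
    intro s hs
    rw [Measure.map_apply measurable_from_top hs, ← Measure.count_injective_image hinj]
    exact measure_mono (image_preimage_subset _ _)
  calc _ = eLpNorm u q ((Measure.count : Measure ℕ).map (fun k => k + i)) := h.symm
    _ ≤ _ := eLpNorm_mono_measure u h2

/-- Truncated subtraction is injective only on k ≥ i; the cutoff restricts counting measure to that
set before it is pushed forward. -/
theorem eLpNorm_count_shift_le (u : ℕ → ℝ≥0∞) (i : ℕ) (q : ℝ≥0∞) :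
    eLpNorm (fun k => if i ≤ k then u (k - i) else 0) q Measure.count ≤
      eLpNorm u q Measure.count := by
  have h0 : (fun k => if i ≤ k then u (k - i) else 0) =
      indicator (Ici i) (fun k => u (k - i)) := by
    ext k
    simp [indicator]
  have h := eLpNorm_map_measure (p := q)
    (μ := (Measure.count : Measure ℕ).restrict (Ici i))
    (f := fun k : ℕ => k - i) (g := u)
    (measurable_from_top.aestronglyMeasurable) measurable_from_top.aemeasurable
  have h2 : ((Measure.count : Measure ℕ).restrict (Ici i)).map (fun k => k - i) ≤
      Measure.count := by
    rw [Measure.le_iff]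
    intro s hs
    rw [Measure.map_apply measurable_from_top hs, Measure.restrict_apply (by trivial),
      ← Measure.count_injective_image (add_left_injective i) s]
    refine measure_mono fun k hk => ⟨k - i, hk.1, ?_⟩
    have := hk.2
    simp only [mem_Ici] at this
    simp [Nat.sub_add_cancel this]
  rw [h0, eLpNorm_indicator_eq_eLpNorm_restrict (by trivial)]
  exact h.symm.le.trans (eLpNorm_mono_measure u h2)

/-- Every j is k + i or k - i for some i. The diagonal j = k is counted twice, which is why Young's
inequality below has the constant 2/(1-x). -/
theorem tsum_nat_le_two_sided (f : ℕ → ℝ≥0∞) (k : ℕ) :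
    ∑' j, f j ≤ ∑' i, (f (k + i) + if i ≤ k then f (k - i) else 0) := by
  rw [ENNReal.tsum_add, ← Summable.sum_add_tsum_nat_add' (f := f) (k := k) ENNReal.summable,
    add_comm]
  gcongr with i
  · rw [add_comm]
  · have h : ∑' i, (if i ≤ k then f (k - i) else 0) =
        ∑ i ∈ Finset.range (k + 1), f (k - i) := by
      rw [tsum_eq_sum (s := Finset.range (k + 1))
        (fun i hi => by simp only [Finset.mem_range] at hi; simp; omega)]
      exact Finset.sum_congr rfl fun i hi => by
        simp only [Finset.mem_range] at hi
        simp; omega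
    have h' := Finset.sum_range_reflect f (k + 1)
    simp only [Nat.add_sub_cancel] at h'
    rw [h, show ∑ i ∈ Finset.range (k + 1), f (k - i) = ∑ i ∈ Finset.range (k + 1), f i from
      (Finset.sum_congr rfl fun i _ => by congr 1).trans h']
    exact Finset.sum_le_sum_of_subset (Finset.range_subset_range.2 (Nat.le_succ k))

/-- Young's inequality for the kernel `x ^ |k - j|` on `ℕ`. -/
theorem eLpNorm_count_conv_le (u : ℕ → ℝ≥0∞) {x : ℝ} (hx0 : 0 ≤ x) (hx1 : x < 1)
    {q : ℝ≥0∞} (hq : 1 ≤ q) :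
    eLpNorm (fun k => ∑' j, ENNReal.ofReal (x ^ Nat.dist k j) * u j) q Measure.count ≤
      ENNReal.ofReal (2 / (1 - x)) * eLpNorm u q Measure.count := by
  set v : ℕ → ℕ → ℝ≥0∞ := fun i k => ENNReal.ofReal (x ^ i) * u (k + i)
  set w : ℕ → ℕ → ℝ≥0∞ := fun i k => ENNReal.ofReal (x ^ i) * if i ≤ k then u (k - i) else 0
  have hm : ∀ f : ℕ → ℝ≥0∞, AEMeasurable f Measure.count :=
    fun f => measurable_from_top.aemeasurable
  calc _ ≤ eLpNorm (fun k => ∑' i, (v i + w i) k) q Measure.count := by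
        refine eLpNorm_mono_enorm fun k => ?_
        simp only [enorm_eq_self]
        refine (tsum_nat_le_two_sided _ k).trans (le_of_eq (tsum_congr fun i => ?_))
        simp only [Pi.add_apply, v, w]
        congr 1
        · simp [Nat.dist]
        · split_ifs with h
          · have : Nat.dist k (k - i) = i := by simp only [Nat.dist]; omega
            rw [this]
          · simp
    _ ≤ ∑' i, eLpNorm (v i + w i) q Measure.count :=
        eLpNorm_tsum_le_ennreal (u := fun i => v i + w i) (fun i => hm _) hq
    _ ≤ ∑' i, ENNReal.ofReal (x ^ i) * (2 * eLpNorm u q Measure.count) := by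
        refine ENNReal.tsum_le_tsum fun i => ?_
        refine (eLpNorm_add_le (hm _).aestronglyMeasurable (hm _).aestronglyMeasurable hq).trans ?_
        rw [eLpNorm_const_mul_ennreal _ _ (hm _) hq, eLpNorm_const_mul_ennreal _ _ (hm _) hq,
          ← mul_add, two_mul]
        gcongr
        · exact eLpNorm_count_comp_add_le u i q
        · exact eLpNorm_count_shift_le u i q
    _ = _ := by
        rw [ENNReal.tsum_mul_right, ← mul_assoc,
          ← ENNReal.ofReal_tsum_of_nonneg (fun i => by positivity)
            (summable_geometric_of_lt_one hx0 hx1), tsum_geometric_of_lt_one hx0 hx1,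
          div_eq_inv_mul, ENNReal.ofReal_mul (by rw [inv_nonneg]; linarith)]
        simp

end Convolution

/-! ## Absolutely convergent series in `L^p` -/

section Series

variable {X : Type*} {mX : MeasurableSpace X} {m : Measure X} {p : ℝ≥0∞}

theorem tsum_comm_of_enorm {ι κ : Type*} (f : ι → κ → ℂ)
    (h : ∑' i, ∑' k, ‖f i k‖ₑ < ∞) : ∑' i, ∑' k, f i k = ∑' k, ∑' i, f i k := by
  have hs : Summable (Function.uncurry f) := by
    refine Summable.of_enorm ?_
    rw [ENNReal.tsum_prod']
    exact h.ne
  exact hs.tsum_comm.symm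

theorem aemeasurable_tsum_ennreal {ι : Type*} [Countable ι] {u : ι → X → ℝ≥0∞}
    (hu : ∀ i, AEMeasurable (u i) m) : AEMeasurable (fun x => ∑' i, u i x) m := by
  exact AEMeasurable.tsum hu

theorem ae_lt_top_of_eLpNorm_lt_top {u : X → ℝ≥0∞} (hu : AEMeasurable u m) (hp : 1 ≤ p)
    (h : eLpNorm u p m < ∞) : ∀ᵐ x ∂m, u x < ∞ := by
  have hp0 : p ≠ 0 := (zero_lt_one.trans_le hp).ne'
  rcases eq_or_ne p ∞ with rfl | htop
  · have h1 : ∀ᵐ x ∂m, ‖u x‖ₑ ≤ eLpNormEssSup u m := ae_le_eLpNormEssSup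
    filter_upwards [h1] with x hx
    exact hx.trans_lt (by simpa using h)
  · have hr : 0 < p.toReal := ENNReal.toReal_pos hp0 htop
    have h1 := lintegral_rpow_enorm_lt_top_of_eLpNorm_lt_top hp0 htop h
    filter_upwards [ae_lt_top' (hu.enorm.pow_const _) h1.ne] with x hx
    exact (ENNReal.rpow_lt_top_iff_of_pos hr).1 hx

theorem ae_tsum_enorm_lt_top {u : ℕ → X → ℂ} (hu : ∀ k, AEStronglyMeasurable (u k) m)
    (hp : 1 ≤ p) (hsum : ∑' k, eLpNorm (u k) p m < ∞) :
    ∀ᵐ x ∂m, ∑' k, ‖u k x‖ₑ < ∞ := by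
  refine ae_lt_top_of_eLpNorm_lt_top (aemeasurable_tsum_ennreal fun k => (hu k).enorm) hp ?_
  refine (eLpNorm_tsum_le_ennreal (fun k => (hu k).enorm) hp).trans_lt ?_
  simpa only [eLpNorm_enorm] using hsum

/-- If a series converges absolutely in `L^p`, its pointwise sum is its limit in `L^p`. -/
theorem memLp_tendsto_of_ae_eq_tsum {u : ℕ → X → ℂ} {f : X → ℂ}
    (hu : ∀ k, AEStronglyMeasurable (u k) m) (hp : 1 ≤ p)
    (hsum : ∑' k, eLpNorm (u k) p m < ∞) (hf : f =ᵐ[m] fun x => ∑' k, u k x) :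
    MemLp f p m ∧ Tendsto (fun n => eLpNorm (fun x => f x - ∑ k ∈ Finset.range n, u k x) p m)
      atTop (𝓝 0) := by
  have hae := ae_tsum_enorm_lt_top hu hp hsum
  -- Where the series converges absolutely, the error after n terms is the tail, and Minkowski
  -- bounds its norm by the tail of a convergent numerical series.
  have hbound : ∀ n, eLpNorm (fun x => f x - ∑ k ∈ Finset.range n, u k x) p m ≤
      ∑' k, eLpNorm (u (k + n)) p m := by
    intro n
    calc _ ≤ eLpNorm (fun x => ∑' k, ‖u (k + n) x‖ₑ) p m := by
          refine eLpNorm_mono_enorm_ae ?_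
          filter_upwards [hae, hf] with x hx hfx
          have hs : Summable fun k => u k x := Summable.of_enorm hx.ne
          rw [hfx, ← hs.sum_add_tsum_nat_add n, add_sub_cancel_left]
          exact enorm_tsum_le_tsum_enorm
      _ ≤ _ := by
          refine (eLpNorm_tsum_le_ennreal (fun k => (hu (k + n)).enorm) hp).trans ?_
          simp only [eLpNorm_enorm, le_refl]
  have hmeas : AEStronglyMeasurable f m := by
    refine aestronglyMeasurable_of_tendsto_ae atTop
      (f := fun n x => ∑ k ∈ Finset.range n, u k x)
      (fun n => Finset.aestronglyMeasurable_fun_sum _ fun k _ => hu k) ?_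
    filter_upwards [hae, hf] with x hx hfx
    rw [hfx]
    exact (Summable.of_enorm hx.ne : Summable fun k => u k x).hasSum.tendsto_sum_nat
  refine ⟨⟨hmeas, ?_⟩, ?_⟩
  · have := hbound 0
    simp only [Finset.range_zero, Finset.sum_empty, sub_zero, add_zero] at this
    exact this.trans_lt hsum
  · exact tendsto_of_tendsto_of_tendsto_of_le_of_le tendsto_const_nhds
      (ENNReal.tendsto_sum_nat_add _ hsum.ne) (fun _ => zero_le) hbound

/-- The limit in `L^p` of an absolutely convergent series is its pointwise sum. -/
theorem ae_eq_tsum_of_tendsto {u : ℕ → X → ℂ} {f : X → ℂ}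
    (hu : ∀ k, AEStronglyMeasurable (u k) m) (hp : 1 ≤ p)
    (hsum : ∑' k, eLpNorm (u k) p m < ∞) (hfm : AEStronglyMeasurable f m)
    (hf : Tendsto (fun n => eLpNorm (fun x => f x - ∑ k ∈ Finset.range n, u k x) p m)
      atTop (𝓝 0)) :
    f =ᵐ[m] fun x => ∑' k, u k x := by
  set g : X → ℂ := fun x => ∑' k, u k x
  obtain ⟨hg, hgt⟩ := memLp_tendsto_of_ae_eq_tsum hu hp hsum (f := g) (ae_eq_refl _)
  -- The partial sums converge in L^p both to f and to the pointwise sum g, so the triangle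
  -- inequality forces f = g almost everywhere.
  have hle : ∀ n, eLpNorm (f - g) p m ≤
      eLpNorm (fun x => f x - ∑ k ∈ Finset.range n, u k x) p m +
      eLpNorm (fun x => g x - ∑ k ∈ Finset.range n, u k x) p m := by
    intro n
    have hm : AEStronglyMeasurable (fun x => ∑ k ∈ Finset.range n, u k x) m :=
      Finset.aestronglyMeasurable_fun_sum _ fun k _ => hu k
    refine le_trans (le_of_eq ?_) (eLpNorm_sub_le (hfm.sub hm) (hg.1.sub hm) hp)
    congr 1
    ext x
    simp
  have h0 : eLpNorm (f - g) p m = 0 := by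
    refine le_antisymm ?_ zero_le
    exact ge_of_tendsto' (by simpa using hf.add hgt) hle
  rw [eLpNorm_eq_zero_iff (hfm.sub hg.1) (zero_lt_one.trans_le hp).ne'] at h0
  filter_upwards [h0] with x hx
  exact sub_eq_zero.1 hx

end Series

/-! ## Series of atoms on disjoint sets -/

section Levels

variable {X : Type*} {mX : MeasurableSpace X} {m : Measure X} {p : ℝ}

/-- The `L^p` norm of a sum of functions with disjoint supports. -/
theorem eLpNorm_sum_le_of_disjoint {ι : Type*} (hp : 1 ≤ p) (S : Finset ι)
    {v : ι → X → ℝ≥0∞} (hv : ∀ i ∈ S, AEMeasurable (v i) m)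
    (hdisj : ∀ x, ∀ i ∈ S, ∀ j ∈ S, v i x ≠ 0 → v j x ≠ 0 → i = j) :
    eLpNorm (fun x => ∑ i ∈ S, v i x) (ENNReal.ofReal p) m ≤
      lpSum p S (fun i => eLpNorm (v i) (ENNReal.ofReal p) m) := by
  have hp0 : 0 < p := by linarith
  have hform : ∀ w : X → ℝ≥0∞,
      eLpNorm w (ENNReal.ofReal p) m = (∫⁻ x, w x ^ p ∂m) ^ (1 / p) := by
    intro w
    rw [eLpNorm_eq_lintegral_rpow_enorm_toReal (by simpa using hp0) ENNReal.ofReal_ne_top,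
      ENNReal.toReal_ofReal hp0.le]
    simp
  simp only [hform, lpSum]
  refine ENNReal.rpow_le_rpow ?_ (by positivity)
  have h1 : ∀ x, (∑ i ∈ S, v i x) ^ p = ∑ i ∈ S, v i x ^ p := by
    intro x
    by_cases h : ∃ i ∈ S, v i x ≠ 0
    · obtain ⟨i, hi, hne⟩ := h
      have h0 : ∀ j ∈ S, j ≠ i → v j x = 0 := fun j hj hji => by
        by_contra hj0
        exact hji (hdisj x j hj i hi hj0 hne)
      rw [Finset.sum_eq_single i h0 (fun h => absurd hi h),
        Finset.sum_eq_single i (fun j hj hji => by simp [h0 j hj hji, hp0])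
          (fun h => absurd hi h)]
    · push Not at h
      rw [Finset.sum_eq_zero h, Finset.sum_eq_zero (fun i hi => by simp [h i hi, hp0])]
      simp [hp0]
  simp only [h1]
  rw [lintegral_finsetSum' _ fun i hi => (hv i hi).pow_const _]
  refine Finset.sum_le_sum fun i _ => ?_
  rw [← ENNReal.rpow_mul, one_div_mul_cancel hp0.ne', ENNReal.rpow_one]

theorem measurable_souzaAtom (p s : ℝ) {Q : Set X} (hQ : MeasurableSet Q) :
    Measurable (souzaAtom m p s Q) :=
  measurable_const.indicator hQ

theorem eLpNorm_souzaAtom_le [IsFiniteMeasure m] (hp : 1 ≤ p) (s : ℝ) {Q : Set X}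
    (hQ : MeasurableSet Q) :
    eLpNorm (souzaAtom m p s Q) (ENNReal.ofReal p) m ≤ ENNReal.ofReal (m.real Q ^ s) := by
  have hp0 : 0 < p := by linarith
  have h0 : 0 ≤ m.real Q := measureReal_nonneg
  rw [souzaAtom, eLpNorm_indicator_const hQ (by simpa using hp0) ENNReal.ofReal_ne_top,
    ENNReal.toReal_ofReal hp0.le, ← ofReal_measureReal, ENNReal.ofReal_rpow_of_nonneg h0
    (by positivity), ← ofReal_norm, ← ENNReal.ofReal_mul (norm_nonneg _)]
  refine ENNReal.ofReal_le_ofReal ?_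
  rw [Complex.norm_real, Real.norm_of_nonneg (by positivity)]
  -- For a null Q the factor |Q|^{1/p} kills the left side, whatever value the power of zero with
  -- exponent s - 1/p takes. Exponents may be added only when |Q| > 0.
  rcases h0.eq_or_lt with h | h
  · rw [← h, Real.zero_rpow (by positivity : (1 / p : ℝ) ≠ 0), mul_zero]
    positivity
  · rw [← Real.rpow_add h]
    simp

/-- The `ℓ^q(ℓ^p)` norm of a family of elements of `ℝ≥0∞` indexed by a grid. -/
def coefNormE (p : ℝ) (q : ℝ≥0∞) (P : ℕ → Finset (Set X)) (Z : Set X → ℝ≥0∞) : ℝ≥0∞ :=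
  eLpNorm (fun k : ℕ => lpSum p (P k) Z) q Measure.count

theorem coefNorm_eq_coefNormE (p : ℝ) (q : ℝ≥0∞) (P : ℕ → Finset (Set X)) (d : Set X → ℂ) :
    coefNorm p q P d = coefNormE p q P (fun Q => ‖d Q‖ₑ) := rfl

variable {q : ℝ≥0∞} {P : ℕ → Finset (Set X)}

theorem eLpNorm_count_mono {u v : ℕ → ℝ≥0∞} (h : ∀ k, u k ≤ v k) :
    eLpNorm u q Measure.count ≤ eLpNorm v q Measure.count :=
  eLpNorm_mono_enorm fun k => by simpa using h k

theorem coefNormE_mono (hp : 1 ≤ p) {Z Z' : Set X → ℝ≥0∞}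
    (h : ∀ k, ∀ Q ∈ P k, Z Q ≤ Z' Q) : coefNormE p q P Z ≤ coefNormE p q P Z' :=
  eLpNorm_count_mono fun k => lpSum_mono hp (h k)

theorem lpSum_le_coefNormE (hq : 1 ≤ q) (Z : Set X → ℝ≥0∞) (k : ℕ) :
    lpSum p (P k) Z ≤ coefNormE p q P Z := by
  have := enorm_le_eLpNorm_count (p := q) (fun k : ℕ => lpSum p (P k) Z) k
    (zero_lt_one.trans_le hq).ne'
  rwa [enorm_eq_self] at this

theorem coefNormE_const_mul (hp : 1 ≤ p) (hq : 1 ≤ q) (c : ℝ≥0∞) (Z : Set X → ℝ≥0∞) :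
    coefNormE p q P (fun Q => c * Z Q) = c * coefNormE p q P Z := by
  simp only [coefNormE, lpSum_const_mul hp]
  exact eLpNorm_const_mul_ennreal c _ measurable_from_top.aemeasurable hq

theorem coefNormE_tsum_le (hp : 1 ≤ p) (hq : 1 ≤ q) {ι : Type*} [Countable ι]
    (Z : ι → Set X → ℝ≥0∞) :
    coefNormE p q P (fun Q => ∑' i, Z i Q) ≤ ∑' i, coefNormE p q P (Z i) :=
  (eLpNorm_count_mono fun k => lpSum_tsum_le hp (P k) Z).trans
    (eLpNorm_tsum_le_ennreal (u := fun i k => lpSum p (P k) (Z i))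
      (fun _ => measurable_from_top.aemeasurable) hq)

theorem coefNorm_const_mul (hp : 1 ≤ p) (hq : 1 ≤ q) (c : ℂ) (d : Set X → ℂ) :
    coefNorm p q P (fun Q => c * d Q) = ‖c‖ₑ * coefNorm p q P d := by
  simp only [coefNorm_eq_coefNormE, enorm_mul]
  exact coefNormE_const_mul hp hq _ _

theorem coefNorm_tsum_le (hp : 1 ≤ p) (hq : 1 ≤ q) {ι : Type*} [Countable ι]
    (z : ι → Set X → ℂ) :
    coefNorm p q P (fun Q => ∑' i, z i Q) ≤ ∑' i, coefNorm p q P (z i) :=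
  (coefNormE_mono hp fun _ _ _ => enorm_tsum_le_tsum_enorm).trans
    (coefNormE_tsum_le hp hq fun i Q => ‖z i Q‖ₑ)

/-- The levels consist of disjoint measurable sets, and `|Q| ^ s` is bounded on the levels by a
summable sequence. -/
structure IsDecayingGrid (m : Measure X) (P : ℕ → Finset (Set X)) (s : ℝ) (θ : ℕ → ℝ≥0∞) :
    Prop where
  measurableSet : ∀ k, ∀ Q ∈ P k, MeasurableSet Q
  disjoint : ∀ k, ∀ Q ∈ P k, ∀ R ∈ P k, Q ≠ R → Disjoint Q R
  size_le : ∀ k, ∀ Q ∈ P k, ENNReal.ofReal (m.real Q ^ s) ≤ θ k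
  tsum_lt_top : ∑' k, θ k < ∞

/-- The sum of the absolute values of the terms of level `k` of a series of Souza atoms. -/
def absLevel (m : Measure X) (p s : ℝ) (P : ℕ → Finset (Set X)) (Z : Set X → ℝ≥0∞) (k : ℕ)
    (x : X) : ℝ≥0∞ :=
  ∑ Q ∈ P k, Z Q * ‖souzaAtom m p s Q x‖ₑ

variable {s : ℝ} {θ : ℕ → ℝ≥0∞}

theorem enorm_level_le (d : Set X → ℂ) (k : ℕ) (x : X) :
    ‖∑ Q ∈ P k, d Q * souzaAtom m p s Q x‖ₑ ≤ absLevel m p s P (fun Q => ‖d Q‖ₑ) k x :=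
  (enorm_sum_le _ _).trans (by simp [absLevel, enorm_mul])

theorem exists_isSouzaRep_of_besovNorm_lt {f : X → ℂ} {M : ℝ≥0∞}
    (h : besovNorm m p q P s f < M) :
    ∃ d, IsSouzaRep m p q P s f d ∧ coefNorm p q P d < M := by
  simpa [besovNorm, iInf_lt_iff] using h

namespace IsDecayingGrid

theorem aemeasurable_absLevel (hP : IsDecayingGrid m P s θ) (Z : Set X → ℝ≥0∞) (k : ℕ) :
    AEMeasurable (absLevel m p s P Z k) m :=
  Finset.aemeasurable_fun_sum _ fun Q hQ =>
    ((measurable_souzaAtom p s (hP.measurableSet k Q hQ)).enorm.const_mul _).aemeasurable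

theorem aestronglyMeasurable_level (hP : IsDecayingGrid m P s θ) (d : Set X → ℂ) (k : ℕ) :
    AEStronglyMeasurable (fun x => ∑ Q ∈ P k, d Q * souzaAtom m p s Q x) m :=
  (Finset.measurable_fun_sum _ fun Q hQ =>
    (measurable_souzaAtom p s (hP.measurableSet k Q hQ)).const_mul _).aestronglyMeasurable

/-- Atoms of one level have disjoint supports, so their L^p norms combine in ℓ^p. Each is at most
|Q|^s, which the decay bound controls; summing over levels then costs only ∑ θ. -/
theorem eLpNorm_absLevel_le [IsFiniteMeasure m] (hP : IsDecayingGrid m P s θ) (hp : 1 ≤ p)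
    (Z : Set X → ℝ≥0∞) (k : ℕ) :
    eLpNorm (absLevel m p s P Z k) (ENNReal.ofReal p) m ≤ θ k * lpSum p (P k) Z := by
  have hp' : 1 ≤ ENNReal.ofReal p := by simpa using hp
  refine (eLpNorm_sum_le_of_disjoint hp (P k) (v := fun Q x => Z Q * ‖souzaAtom m p s Q x‖ₑ)
    (fun Q hQ => ((measurable_souzaAtom p s
      (hP.measurableSet k Q hQ)).enorm.const_mul _).aemeasurable) ?_).trans ?_
  · intro x Q hQ R hR h1 h2
    by_contra hne
    have hd := hP.disjoint k Q hQ R hR hne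
    have hxQ : x ∈ Q := by
      by_contra hx
      simp [souzaAtom, hx] at h1
    have hxR : x ∈ R := by
      by_contra hx
      simp [souzaAtom, hx] at h2
    exact Set.disjoint_left.1 hd hxQ hxR
  · rw [← lpSum_const_mul hp]
    refine lpSum_mono hp fun Q hQ => ?_
    have hm := measurable_souzaAtom (m := m) p s (hP.measurableSet k Q hQ)
    rw [eLpNorm_const_mul_ennreal _ _ hm.enorm.aemeasurable hp', eLpNorm_enorm, mul_comm]
    gcongr
    exact (eLpNorm_souzaAtom_le hp s (hP.measurableSet k Q hQ)).trans (hP.size_le k Q hQ)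

theorem tsum_eLpNorm_absLevel_le [IsFiniteMeasure m] (hP : IsDecayingGrid m P s θ) (hp : 1 ≤ p)
    (hq : 1 ≤ q) (Z : Set X → ℝ≥0∞) :
    ∑' k, eLpNorm (absLevel m p s P Z k) (ENNReal.ofReal p) m ≤
      (∑' k, θ k) * coefNormE p q P Z := by
  rw [← ENNReal.tsum_mul_right]
  refine ENNReal.tsum_le_tsum fun k => (hP.eLpNorm_absLevel_le hp Z k).trans ?_
  gcongr
  exact lpSum_le_coefNormE hq Z k

theorem tsum_eLpNorm_level_le [IsFiniteMeasure m] (hP : IsDecayingGrid m P s θ) (hp : 1 ≤ p)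
    (hq : 1 ≤ q) (d : Set X → ℂ) :
    ∑' k, eLpNorm (fun x => ∑ Q ∈ P k, d Q * souzaAtom m p s Q x) (ENNReal.ofReal p) m ≤
      (∑' k, θ k) * coefNorm p q P d := by
  refine le_trans ?_ (hP.tsum_eLpNorm_absLevel_le hp hq _)
  exact ENNReal.tsum_le_tsum fun k => eLpNorm_mono_enorm fun x => by
    simpa using enorm_level_le d k x

theorem ae_tsum_absLevel_lt_top [IsFiniteMeasure m] (hP : IsDecayingGrid m P s θ) (hp : 1 ≤ p)
    (hq : 1 ≤ q) {Z : Set X → ℝ≥0∞} (hZ : coefNormE p q P Z < ∞) :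
    ∀ᵐ x ∂m, ∑' k, absLevel m p s P Z k x < ∞ := by
  have hp' : 1 ≤ ENNReal.ofReal p := by simpa using hp
  refine ae_lt_top_of_eLpNorm_lt_top
    (aemeasurable_tsum_ennreal fun k => hP.aemeasurable_absLevel Z k) hp' ?_
  exact ((eLpNorm_tsum_le_ennreal (fun k => hP.aemeasurable_absLevel Z k) hp').trans
    (hP.tsum_eLpNorm_absLevel_le hp hq Z)).trans_lt (ENNReal.mul_lt_top hP.tsum_lt_top hZ)

/-- On a decaying grid, a representation is a pointwise identity. -/
theorem isSouzaRep_iff [IsFiniteMeasure m] (hP : IsDecayingGrid m P s θ) (hp : 1 ≤ p)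
    (hq : 1 ≤ q) {f : X → ℂ} {d : Set X → ℂ} :
    IsSouzaRep m p q P s f d ↔ coefNorm p q P d < ∞ ∧
      f =ᵐ[m] fun x => ∑' k, ∑ Q ∈ P k, d Q * souzaAtom m p s Q x := by
  have hp' : 1 ≤ ENNReal.ofReal p := by simpa using hp
  constructor
  · intro h
    exact ⟨h.coefNorm_lt_top, ae_eq_tsum_of_tendsto (hP.aestronglyMeasurable_level d) hp'
      h.abs_convergent h.memLp.1 h.tendsto⟩
  · rintro ⟨hd, hf⟩
    have hsum := (hP.tsum_eLpNorm_level_le hp hq d).trans_lt (ENNReal.mul_lt_top hP.tsum_lt_top hd)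
    obtain ⟨h1, h2⟩ := memLp_tendsto_of_ae_eq_tsum (hP.aestronglyMeasurable_level d) hp' hsum hf
    exact ⟨h1, hd, hsum, h2⟩

theorem eLpNorm_le [IsFiniteMeasure m] (hP : IsDecayingGrid m P s θ) (hp : 1 ≤ p) (hq : 1 ≤ q)
    {f : X → ℂ} {d : Set X → ℂ} (h : IsSouzaRep m p q P s f d) :
    eLpNorm f (ENNReal.ofReal p) m ≤ (∑' k, θ k) * coefNorm p q P d := by
  have hp' : 1 ≤ ENNReal.ofReal p := by simpa using hp
  refine le_trans ?_ (hP.tsum_eLpNorm_level_le hp hq d)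
  calc _ ≤ eLpNorm (fun x => ∑' k, ‖∑ Q ∈ P k, d Q * souzaAtom m p s Q x‖ₑ)
        (ENNReal.ofReal p) m := by
        refine eLpNorm_mono_enorm_ae ?_
        filter_upwards [((hP.isSouzaRep_iff hp hq).1 h).2] with x hx
        rw [hx]
        exact enorm_tsum_le_tsum_enorm
    _ ≤ _ := by
        refine (eLpNorm_tsum_le_ennreal
          (fun k => (hP.aestronglyMeasurable_level d k).enorm) hp').trans ?_
        simp only [eLpNorm_enorm, le_refl]

/-- Superposition of countably many representations. -/
theorem isSouzaRep_tsum [IsFiniteMeasure m] (hP : IsDecayingGrid m P s θ) (hp : 1 ≤ p)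
    (hq : 1 ≤ q) {ι : Type*} [Countable ι] {f : ι → X → ℂ} {z : ι → Set X → ℂ} {F : X → ℂ}
    (hz : ∀ i, IsSouzaRep m p q P s (f i) (z i))
    (hfin : coefNormE p q P (fun Q => ∑' i, ‖z i Q‖ₑ) < ∞)
    (hF : F =ᵐ[m] fun x => ∑' i, f i x) :
    IsSouzaRep m p q P s F (fun Q => ∑' i, z i Q) := by
  refine (hP.isSouzaRep_iff hp hq).2 ⟨?_, ?_⟩
  · exact (coefNormE_mono hp fun _ _ _ => enorm_tsum_le_tsum_enorm).trans_lt hfin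
  have h1 : ∀ᵐ x ∂m, ∀ i, f i x = ∑' k, ∑ Q ∈ P k, z i Q * souzaAtom m p s Q x :=
    ae_all_iff.2 fun i => ((hP.isSouzaRep_iff hp hq).1 (hz i)).2
  filter_upwards [hF, h1, hP.ae_tsum_absLevel_lt_top hp hq hfin] with x hFx hx hfinx
  -- The series with coefficients ∑_i |z_i| dominates everything and is finite at almost every x,
  -- which permits exchanging the sums over i and over levels.
  rw [hFx, tsum_congr hx, tsum_comm_of_enorm]
  · refine tsum_congr fun k => ?_
    rw [Summable.tsum_finsetSum]
    · exact Finset.sum_congr rfl fun Q _ => tsum_mul_right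
    · intro Q hQ
      refine Summable.of_enorm ?_
      simp only [enorm_mul]
      rw [ENNReal.tsum_mul_right]
      refine ne_top_of_le_ne_top ((ENNReal.le_tsum k).trans_lt hfinx).ne ?_
      exact Finset.single_le_sum
        (f := fun Q => (∑' i, ‖z i Q‖ₑ) * ‖souzaAtom m p s Q x‖ₑ) (fun _ _ => zero_le) hQ
  · rw [ENNReal.tsum_comm]
    refine lt_of_le_of_lt (ENNReal.tsum_le_tsum fun k => ?_) hfinx
    calc _ ≤ ∑' i, ∑ Q ∈ P k, ‖z i Q‖ₑ * ‖souzaAtom m p s Q x‖ₑ :=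
          ENNReal.tsum_le_tsum fun i => enorm_level_le (z i) k x
      _ = _ := by
          rw [Summable.tsum_finsetSum fun _ _ => ENNReal.summable]
          exact Finset.sum_congr rfl fun Q _ => ENNReal.tsum_mul_right

theorem isSouzaRep_const_mul [IsFiniteMeasure m] (hP : IsDecayingGrid m P s θ) (hp : 1 ≤ p)
    (hq : 1 ≤ q) {f : X → ℂ} {d : Set X → ℂ} (h : IsSouzaRep m p q P s f d) (c : ℂ) :
    IsSouzaRep m p q P s (fun x => c * f x) (fun Q => c * d Q) := by
  obtain ⟨h1, h2⟩ := (hP.isSouzaRep_iff hp hq).1 h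
  refine (hP.isSouzaRep_iff hp hq).2 ⟨?_, ?_⟩
  · rw [coefNorm_const_mul hp hq]
    exact ENNReal.mul_lt_top enorm_lt_top h1
  · filter_upwards [h2] with x hx
    simp only [hx, mul_assoc, ← Finset.mul_sum, tsum_mul_left]

theorem isSouzaRep_zero [IsFiniteMeasure m] (hP : IsDecayingGrid m P s θ) (hp : 1 ≤ p)
    (hq : 1 ≤ q) : IsSouzaRep m p q P s (fun _ => 0) (fun _ => 0) := by
  refine (hP.isSouzaRep_iff hp hq).2 ⟨?_, by simp⟩
  have : coefNorm p q P (fun _ => 0) = 0 := by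
    have := coefNorm_const_mul (P := P) hp hq 0 (fun _ => 0)
    simpa using this
  rw [this]
  simp

theorem isSouzaRep_sum [IsFiniteMeasure m] (hP : IsDecayingGrid m P s θ) (hp : 1 ≤ p)
    (hq : 1 ≤ q) {ι : Type*} (S : Finset ι) {f : ι → X → ℂ} {z : ι → Set X → ℂ}
    (hz : ∀ i ∈ S, IsSouzaRep m p q P s (f i) (z i)) :
    IsSouzaRep m p q P s (fun x => ∑ i ∈ S, f i x) (fun Q => ∑ i ∈ S, z i Q) := by
  have h := hP.isSouzaRep_tsum hp hq (ι := S) (f := fun i => f i) (z := fun i => z i)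
    (F := fun x => ∑ i ∈ S, f i x) (fun i => hz i i.2) ?_ ?_
  · convert h using 2 with Q
    rw [tsum_fintype, Finset.sum_coe_sort S (fun i => z i Q)]
  · refine (coefNormE_tsum_le hp hq fun (i : S) Q => ‖z i Q‖ₑ).trans_lt ?_
    rw [tsum_fintype]
    exact ENNReal.sum_lt_top.2 fun i _ => (hz i i.2).coefNorm_lt_top
  · refine ae_of_all _ fun x => ?_
    simp only
    rw [tsum_fintype, Finset.sum_coe_sort S (fun i => f i x)]

theorem besovNorm_const_mul_le [IsFiniteMeasure m] (hP : IsDecayingGrid m P s θ) (hp : 1 ≤ p)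
    (hq : 1 ≤ q) (f : X → ℂ) (c : ℂ) :
    besovNorm m p q P s (fun x => c * f x) ≤ ‖c‖ₑ * besovNorm m p q P s f := by
  -- For c = 0 the right side is 0 even if the norm of f is ∞, so the zero function needs its own
  -- representation; division by |c| handles the rest.
  rcases eq_or_ne c 0 with rfl | hc
  · simp only [zero_mul, enorm_zero, nonpos_iff_eq_zero]
    refine le_antisymm (iInf₂_le_of_le _ (hP.isSouzaRep_zero hp hq) ?_) zero_le
    have := coefNorm_const_mul (P := P) hp hq 0 (fun _ => 0)
    simp only [mul_zero, enorm_zero, zero_mul] at this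
    exact this.le
  · have hc' : ‖c‖ₑ ≠ 0 := by simpa using hc
    rw [mul_comm, ← ENNReal.div_le_iff hc' enorm_ne_top]
    refine le_iInf₂ fun d hd => ?_
    rw [ENNReal.div_le_iff hc' enorm_ne_top, mul_comm, ← coefNorm_const_mul hp hq]
    exact iInf₂_le _ (hP.isSouzaRep_const_mul hp hq hd c)

theorem eLpNorm_le_besovNorm [IsFiniteMeasure m] (hP : IsDecayingGrid m P s θ) (hp : 1 ≤ p)
    (hq : 1 ≤ q) (f : X → ℂ) {K : ℝ≥0∞} (hK : ∑' k, θ k ≤ K) (hK0 : K ≠ 0) (hK1 : K ≠ ∞) :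
    eLpNorm f (ENNReal.ofReal p) m ≤ K * besovNorm m p q P s f := by
  rw [mul_comm, ← ENNReal.div_le_iff hK0 hK1]
  refine le_iInf₂ fun d hd => ?_
  rw [ENNReal.div_le_iff hK0 hK1, mul_comm]
  exact (hP.eLpNorm_le hp hq hd).trans (by gcongr)

/-- Near-optimal representations, with errors whose sum is below ε, are superposed. No convergence
of ∑ f_i is assumed: it follows when the sum of the norms is finite, and otherwise there is nothing
to prove. -/
theorem besovNorm_tsum_le [IsFiniteMeasure m] (hP : IsDecayingGrid m P s θ) (hp : 1 ≤ p)
    (hq : 1 ≤ q) {ι : Type*} [Countable ι] {f : ι → X → ℂ} {F : X → ℂ}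
    (hF : F =ᵐ[m] fun x => ∑' i, f i x) :
    besovNorm m p q P s F ≤ ∑' i, besovNorm m p q P s (f i) := by
  by_cases htop : ∑' i, besovNorm m p q P s (f i) = ∞
  · rw [htop]
    exact le_top
  refine ENNReal.le_of_forall_pos_le_add fun ε hε _ => ?_
  obtain ⟨ε', hε', hsum⟩ := ENNReal.exists_pos_sum_of_countable'
    (ENNReal.coe_pos.2 hε).ne' ι
  have hex : ∀ i, ∃ d, IsSouzaRep m p q P s (f i) d ∧
      coefNorm p q P d < besovNorm m p q P s (f i) + ε' i := fun i =>
    exists_isSouzaRep_of_besovNorm_lt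
      (ENNReal.lt_add_right (ENNReal.ne_top_of_tsum_ne_top htop i) (hε' i).ne')
  choose z hz hzn using hex
  have hle : ∑' i, coefNorm p q P (z i) ≤ ∑' i, besovNorm m p q P s (f i) + ε := by
    calc _ ≤ ∑' i, (besovNorm m p q P s (f i) + ε' i) := ENNReal.tsum_le_tsum fun i => (hzn i).le
      _ ≤ _ := by
        rw [ENNReal.tsum_add]
        gcongr
  have hrep := hP.isSouzaRep_tsum hp hq hz ((coefNormE_tsum_le hp hq fun i Q => ‖z i Q‖ₑ).trans_lt
    (hle.trans_lt (ENNReal.add_lt_top.2 ⟨lt_top_iff_ne_top.2 htop, ENNReal.coe_lt_top⟩))) hF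
  exact (iInf₂_le _ hrep).trans ((coefNorm_tsum_le hp hq z).trans hle)

end IsDecayingGrid

end Levels

/-! ## Good grids -/

section GoodGrid

variable {X : Type*} {mX : MeasurableSpace X} {m : Measure X} {P : ℕ → Finset (Set X)}

theorem mem_gridWithin {Ω Q : Set X} {k : ℕ} : Q ∈ gridWithin P Ω k ↔ Q ∈ P k ∧ Q ⊆ Ω := by
  simp [gridWithin]

namespace IsGoodGrid

variable {l₁ l₂ : ℝ}

theorem l₂_pos (hP : IsGoodGrid m P l₁ l₂) : 0 < l₂ := hP.const_pos.trans hP.const_lt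

theorem nonempty (hP : IsGoodGrid m P l₁ l₂) {k : ℕ} {Q : Set X} (hQ : Q ∈ P k) : Q.Nonempty :=
  nonempty_of_measure_ne_zero (hP.measure_pos k Q hQ).ne'

theorem eq_of_mem (hP : IsGoodGrid m P l₁ l₂) {k : ℕ} {Q R : Set X} (hQ : Q ∈ P k)
    (hR : R ∈ P k) {x : X} (hxQ : x ∈ Q) (hxR : x ∈ R) : Q = R := by
  by_contra h
  exact Set.disjoint_left.1 (hP.disjoint k Q hQ R hR h) hxQ hxR

theorem ancestor_unique (hP : IsGoodGrid m P l₁ l₂) {j k : ℕ} {R Q Q' : Set X} (hR : R ∈ P j)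
    (hQ : Q ∈ P k) (hQ' : Q' ∈ P k) (h : R ⊆ Q) (h' : R ⊆ Q') : Q = Q' := by
  obtain ⟨x, hx⟩ := hP.nonempty hR
  exact hP.eq_of_mem hQ hQ' (h hx) (h' hx)

theorem rpow_lt_one (hP : IsGoodGrid m P l₁ l₂) {s : ℝ} (hs : 0 < s) : l₂ ^ s < 1 :=
  Real.rpow_lt_one hP.l₂_pos.le hP.const_lt_one hs

/-- A bound for the `s`-th powers of the measures of the sets of level `k` contained in a set
of level `k₀` and measure `w`. -/
def withinBound (l₂ s w : ℝ) (k₀ k : ℕ) : ℝ≥0∞ :=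
  if k₀ ≤ k then ENNReal.ofReal (w ^ s * (l₂ ^ s) ^ (k - k₀)) else 0

theorem tsum_withinBound (hP : IsGoodGrid m P l₁ l₂) {s : ℝ} (hs : 0 < s) {w : ℝ} (hw : 0 ≤ w)
    (k₀ : ℕ) :
    ∑' k, withinBound l₂ s w k₀ k = ENNReal.ofReal (w ^ s * (1 - l₂ ^ s)⁻¹) := by
  have h0 : 0 ≤ l₂ ^ s := Real.rpow_nonneg hP.l₂_pos.le _
  rw [← Summable.sum_add_tsum_nat_add' (k := k₀) ENNReal.summable,
    Finset.sum_eq_zero (fun k hk => by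
      simp only [Finset.mem_range] at hk
      simp [withinBound, hk]), zero_add]
  simp only [withinBound, Nat.le_add_left, if_true, Nat.add_sub_cancel]
  rw [← ENNReal.ofReal_tsum_of_nonneg (fun k => by positivity)
      ((summable_geometric_of_lt_one h0 (hP.rpow_lt_one hs)).mul_left _), tsum_mul_left,
    tsum_geometric_of_lt_one h0 (hP.rpow_lt_one hs)]

variable [IsProbabilityMeasure m]

theorem real_pos (hP : IsGoodGrid m P l₁ l₂) {k : ℕ} {Q : Set X} (hQ : Q ∈ P k) :
    0 < m.real Q :=
  ENNReal.toReal_pos (hP.measure_pos k Q hQ).ne' (measure_ne_top _ _)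

theorem exists_ancestor (hP : IsGoodGrid m P l₁ l₂) (k i : ℕ) :
    ∀ Q ∈ P (k + i), ∃ R ∈ P k, Q ⊆ R ∧ m.real Q ≤ l₂ ^ i * m.real R := by
  induction i with
  | zero => exact fun Q hQ => ⟨Q, hQ, le_rfl, by simp⟩
  | succ i ih =>
    intro Q hQ
    obtain ⟨R, hR, hQR⟩ := hP.nested (k + i) Q hQ
    obtain ⟨S, hS, hRS, hle⟩ := ih R hR
    refine ⟨S, hS, hQR.trans hRS, ?_⟩
    have h := (hP.ratio (k + i) Q hQ R hR hQR).2
    rw [div_le_iff₀ (hP.real_pos hR)] at h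
    calc m.real Q ≤ l₂ * m.real R := h
      _ ≤ l₂ * (l₂ ^ i * m.real S) := by
        have := hP.l₂_pos
        gcongr
      _ = _ := by ring

theorem level_le_and_real_le (hP : IsGoodGrid m P l₁ l₂) {j k : ℕ} {Q R : Set X} (hQ : Q ∈ P j)
    (hR : R ∈ P k) (h : Q ⊆ R) : k ≤ j ∧ m.real Q ≤ l₂ ^ (j - k) * m.real R := by
  rcases le_or_gt k j with hkj | hjk
  · refine ⟨hkj, ?_⟩
    obtain ⟨i, rfl⟩ := Nat.exists_eq_add_of_le hkj
    obtain ⟨S, hS, hQS, hle⟩ := hP.exists_ancestor k i Q hQ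
    rw [hP.ancestor_unique hQ hR hS h hQS]
    simpa using hle
  -- If R were strictly deeper than Q, the ancestor of R at the level of Q would meet Q, hence equal
  -- Q. Then |Q| ≤ |R| ≤ l₂^{i+1}|Q| < |Q|.
  · exfalso
    obtain ⟨i, rfl⟩ := Nat.exists_eq_add_of_lt hjk
    obtain ⟨S, hS, hRS, hle⟩ := hP.exists_ancestor j (i + 1) R hR
    obtain rfl : Q = S := hP.ancestor_unique hQ hQ hS le_rfl (h.trans hRS)
    have h1 : m.real Q ≤ m.real R := measureReal_mono h
    have h2 : l₂ ^ (i + 1) < 1 := pow_lt_one₀ hP.l₂_pos.le hP.const_lt_one (by omega)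
    nlinarith [hP.real_pos hQ]

theorem level_unique (hP : IsGoodGrid m P l₁ l₂) {j k : ℕ} {Q : Set X} (hQ : Q ∈ P j)
    (hQ' : Q ∈ P k) : j = k :=
  le_antisymm (hP.level_le_and_real_le hQ' hQ le_rfl).1 (hP.level_le_and_real_le hQ hQ' le_rfl).1

theorem real_le (hP : IsGoodGrid m P l₁ l₂) {k : ℕ} {Q : Set X} (hQ : Q ∈ P k) :
    m.real Q ≤ l₂ ^ k := by
  have h := (hP.level_le_and_real_le hQ (by rw [hP.level_zero]; simp : univ ∈ P 0)
    (subset_univ Q)).2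
  simpa using h

theorem isDecayingGrid (hP : IsGoodGrid m P l₁ l₂) {s : ℝ} (hs : 0 < s) :
    IsDecayingGrid m P s (fun k => ENNReal.ofReal ((l₂ ^ s) ^ k)) where
  measurableSet := hP.measurableSet
  disjoint := hP.disjoint
  size_le k Q hQ := by
    refine ENNReal.ofReal_le_ofReal ?_
    rw [← Real.rpow_natCast, ← Real.rpow_mul hP.l₂_pos.le, mul_comm, Real.rpow_mul hP.l₂_pos.le,
      Real.rpow_natCast]
    exact Real.rpow_le_rpow measureReal_nonneg (hP.real_le hQ) hs.le
  tsum_lt_top := by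
    have h0 : 0 ≤ l₂ ^ s := Real.rpow_nonneg hP.l₂_pos.le _
    rw [← ENNReal.ofReal_tsum_of_nonneg (fun k => by positivity)
      (summable_geometric_of_lt_one h0 (hP.rpow_lt_one hs))]
    exact ENNReal.ofReal_lt_top

/-- Keeping the factor |W|^s, instead of a bound by the absolute level, is what makes the later
estimates on W scale correctly. -/
theorem isDecayingGrid_within (hP : IsGoodGrid m P l₁ l₂) {s : ℝ} (hs : 0 < s) {k₀ : ℕ}
    {W : Set X} (hW : W ∈ P k₀) :
    IsDecayingGrid m (gridWithin P W) s (withinBound l₂ s (m.real W) k₀) where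
  measurableSet k Q hQ := hP.measurableSet k Q (mem_gridWithin.1 hQ).1
  disjoint k Q hQ R hR := hP.disjoint k Q (mem_gridWithin.1 hQ).1 R (mem_gridWithin.1 hR).1
  size_le k Q hQ := by
    obtain ⟨hQ1, hQ2⟩ := mem_gridWithin.1 hQ
    obtain ⟨hk, hle⟩ := hP.level_le_and_real_le hQ1 hW hQ2
    rw [withinBound, if_pos hk]
    refine ENNReal.ofReal_le_ofReal ?_
    have hl := hP.l₂_pos.le
    rw [← Real.rpow_natCast, ← Real.rpow_mul hl, mul_comm s, Real.rpow_mul hl, mul_comm,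
      Real.rpow_natCast, ← Real.mul_rpow (by positivity) measureReal_nonneg]
    exact Real.rpow_le_rpow measureReal_nonneg hle hs.le
  tsum_lt_top := by
    rw [hP.tsum_withinBound hs measureReal_nonneg]
    exact ENNReal.ofReal_lt_top

theorem eLpNorm_le_besovNorm_within (hP : IsGoodGrid m P l₁ l₂) {p s : ℝ} {q : ℝ≥0∞}
    (hp : 1 ≤ p) (hq : 1 ≤ q) (hs : 0 < s) {k₀ : ℕ} {W : Set X} (hW : W ∈ P k₀) (f : X → ℂ) :
    eLpNorm f (ENNReal.ofReal p) m ≤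
      ENNReal.ofReal (m.real W ^ s * (1 - l₂ ^ s)⁻¹) * besovNorm m p q (gridWithin P W) s f := by
  have h1 := hP.rpow_lt_one hs
  refine (hP.isDecayingGrid_within hs hW).eLpNorm_le_besovNorm hp hq f
    (hP.tsum_withinBound hs measureReal_nonneg k₀).le ?_ ENNReal.ofReal_ne_top
  have h2 := hP.real_pos hW
  have h3 : 0 < (1 - l₂ ^ s)⁻¹ := by
    rw [inv_pos]
    linarith
  simp only [ne_eq, ENNReal.ofReal_eq_zero, not_le]
  positivity

end IsGoodGrid

end GoodGrid

/-! ## Besov atoms as series of Souza atoms -/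

section Conversion

variable {X : Type*} {mX : MeasurableSpace X} {m : Measure X} {P : ℕ → Finset (Set X)}
  {p s β : ℝ} {q : ℝ≥0∞} {l₁ l₂ : ℝ}

/-- A near-optimal representation of a Besov atom, with nonnegative coefficients for positive
atoms. -/
theorem exists_isSouzaRep_of_isBesovAtom {W : Set X} {b : X → ℂ} (hW : 0 < m.real W)
    (hb : IsBesovAtom m p q P s β W b) :
    ∃ c, IsSouzaRep m p q (gridWithin P W) β b c ∧
      coefNorm p q (gridWithin P W) c ≤ ENNReal.ofReal (2 * m.real W ^ (s - β)) ∧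
      (IsPositiveBesovAtom m p q P s β W b → NonnegCoef (gridWithin P W) c) := by
  have hpos : 0 < m.real W ^ (s - β) := Real.rpow_pos_of_pos hW _
  -- A positive atom comes with a representation meeting the bound exactly. For other atoms the norm
  -- is an infimum that need not be attained, and the factor 2 leaves room.
  by_cases hpa : IsPositiveBesovAtom m p q P s β W b
  · obtain ⟨_, c, hc, hc0, hcn⟩ := hpa
    exact ⟨c, hc, hcn.trans (ENNReal.ofReal_le_ofReal (by linarith)), fun _ => hc0⟩
  · obtain ⟨c, hc, hcn⟩ := exists_isSouzaRep_of_besovNorm_lt (hb.trans_lt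
      ((ENNReal.ofReal_lt_ofReal_iff (by positivity)).2
        (by linarith : m.real W ^ (s - β) < 2 * m.real W ^ (s - β))))
    exact ⟨c, hc, hcn.le, fun h => absurd h hpa⟩

open Classical in
/-- The coefficients for Souza atoms of exponent `s` on the whole grid, made from coefficients for
atoms of exponent `β` on the sets contained in `W`. -/
def changeExponent (m : Measure X) (s β : ℝ) (W : Set X) (c : Set X → ℂ) (R : Set X) : ℂ :=
  if R ⊆ W then c R * ((m.real R ^ (β - s) : ℝ) : ℂ) else 0

/-- The coefficient was chosen so that |R|^{β-s} |R|^{s-1/p} = |R|^{β-1/p}: the two series agree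
term by term, level by level. -/
theorem level_changeExponent [IsProbabilityMeasure m] (hP : IsGoodGrid m P l₁ l₂) (W : Set X)
    (c : Set X → ℂ) (k : ℕ) (x : X) :
    ∑ R ∈ P k, changeExponent m s β W c R * souzaAtom m p s R x =
      ∑ R ∈ gridWithin P W k, c R * souzaAtom m p β R x := by
  classical
  rw [gridWithin, Finset.sum_filter]
  refine Finset.sum_congr rfl fun R hR => ?_
  unfold changeExponent
  split_ifs
  · by_cases hx : x ∈ R
    · simp only [souzaAtom, indicator_of_mem hx, mul_assoc, ← Complex.ofReal_mul]
      rw [← Real.rpow_add (hP.real_pos hR)]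
      rw [show β - s + (s - 1 / p) = β - 1 / p by ring]
    · simp [souzaAtom, hx]
  · simp

theorem isSouzaRep_changeExponent [IsProbabilityMeasure m] (hP : IsGoodGrid m P l₁ l₂)
    (hp : 1 ≤ p) (hsβ : s < β) {W : Set X} {b : X → ℂ}
    {c : Set X → ℂ} (h : IsSouzaRep m p q (gridWithin P W) β b c) :
    IsSouzaRep m p q P s b (changeExponent m s β W c) := by
  have hlev := level_changeExponent (p := p) (s := s) (β := β) hP W c
  refine ⟨h.memLp, lt_of_le_of_lt ?_ h.coefNorm_lt_top, ?_, ?_⟩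
  · refine eLpNorm_count_mono fun k => ?_
    have hp0 : 0 < p := by linarith
    refine ENNReal.rpow_le_rpow ?_ (by positivity)
    classical
    rw [gridWithin, Finset.sum_filter]
    refine Finset.sum_le_sum fun R hR => ?_
    unfold changeExponent
    split_ifs
    · refine ENNReal.rpow_le_rpow ?_ hp0.le
      rw [enorm_mul]
      refine mul_le_of_le_one_right zero_le ?_
      rw [← ofReal_norm, Complex.norm_real, Real.norm_of_nonneg (by positivity),
        ENNReal.ofReal_le_one]
      exact Real.rpow_le_one measureReal_nonneg measureReal_le_one (by linarith)
    · simp [hp0]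
  · simp only [hlev]
    exact h.abs_convergent
  · simp only [hlev]
    exact h.tendsto

/-- Since |R| ≤ l₂^{j-k}|W|, the factor |R|^{β-s} gives the geometric decay times |W|^{β-s}, which
cancels the atom's |W|^{s-β}. Levels j < k hold no subset of W, so writing the gap as `Nat.dist` is
harmless and fits the convolution lemma. -/
theorem lpSum_changeExponent_le [IsProbabilityMeasure m] (hP : IsGoodGrid m P l₁ l₂)
    (hp : 1 ≤ p) (hq : 1 ≤ q) (hsβ : s < β) {k : ℕ} {W : Set X} (hW : W ∈ P k) {c : Set X → ℂ}
    (hc : coefNorm p q (gridWithin P W) c ≤ ENNReal.ofReal (2 * m.real W ^ (s - β))) (j : ℕ) :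
    lpSum p (P j) (fun R => ‖changeExponent m s β W c R‖ₑ) ≤
      ENNReal.ofReal (2 * (l₂ ^ (β - s)) ^ Nat.dist j k) := by
  classical
  have hp0 : 0 < p := by linarith
  have hl := hP.l₂_pos
  have hWpos := hP.real_pos hW
  set K := (l₂ ^ (β - s)) ^ Nat.dist j k * m.real W ^ (β - s) with hK
  have h1 : lpSum p (P j) (fun R => ‖changeExponent m s β W c R‖ₑ) ≤
      lpSum p (gridWithin P W j) (fun R => ENNReal.ofReal K * ‖c R‖ₑ) := by
    rw [lpSum_le_iff hp, lpSum_rpow hp, gridWithin, Finset.sum_filter]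
    refine Finset.sum_le_sum fun R hR => ?_
    unfold changeExponent
    split_ifs with hRW
    · refine ENNReal.rpow_le_rpow ?_ hp0.le
      obtain ⟨hkj, hle⟩ := hP.level_le_and_real_le hR hW hRW
      rw [enorm_mul, mul_comm]
      gcongr
      rw [← ofReal_norm, Complex.norm_real, Real.norm_of_nonneg (by positivity)]
      refine ENNReal.ofReal_le_ofReal ?_
      have hd : Nat.dist j k = j - k := by simp [Nat.dist, hkj]
      rw [hK, hd, ← Real.rpow_natCast, ← Real.rpow_mul hl.le, mul_comm (β - s),
        Real.rpow_mul hl.le, Real.rpow_natCast, ← Real.mul_rpow (by positivity) hWpos.le]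
      exact Real.rpow_le_rpow measureReal_nonneg hle (by linarith)
    · simp [hp0]
  refine h1.trans ?_
  rw [lpSum_const_mul hp]
  calc _ ≤ ENNReal.ofReal K * ENNReal.ofReal (2 * m.real W ^ (s - β)) := by
        gcongr
        exact (lpSum_le_coefNormE hq _ j).trans hc
    _ = _ := by
        rw [← ENNReal.ofReal_mul (by positivity)]
        congr 1
        have : m.real W ^ (β - s) * m.real W ^ (s - β) = 1 := by
          rw [← Real.rpow_add hWpos]
          simp
        rw [hK]
        linear_combination (2 * (l₂ ^ (β - s)) ^ Nat.dist j k) * this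

/-- The factor 2/(1-x), with x = l₂^{β-s}, is Young's constant; the other 2 comes from the
near-optimal representations of the atoms. -/
theorem isBesovToSouzaConst [IsProbabilityMeasure m] (hP : IsGoodGrid m P l₁ l₂)
    (hp : 1 ≤ p) (hq : 1 ≤ q) (hs : 0 < s) (hsβ : s < β) :
    IsBesovToSouzaConst m p q P s β (2 / (1 - l₂ ^ (β - s)) * 2) := by
  classical
  intro f b d hb hrep
  have hp' : 1 ≤ ENNReal.ofReal p := by simpa using hp
  have hD := hP.isDecayingGrid hs
  -- The coefficients are chosen per set, before its level is named, so that they do not depend on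
  -- the level.
  have hex : ∀ Q : Set X, ∃ c : Set X → ℂ, ∀ k, Q ∈ P k →
      IsSouzaRep m p q (gridWithin P Q) β (b Q) c ∧
      coefNorm p q (gridWithin P Q) c ≤ ENNReal.ofReal (2 * m.real Q ^ (s - β)) ∧
      (IsPositiveBesovAtom m p q P s β Q (b Q) → NonnegCoef (gridWithin P Q) c) := by
    intro Q
    by_cases h : ∃ k, Q ∈ P k
    · obtain ⟨k, hk⟩ := h
      obtain ⟨c, hc⟩ := exists_isSouzaRep_of_isBesovAtom (hP.real_pos hk) (hb k Q hk)
      exact ⟨c, fun _ _ => hc⟩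
    · exact ⟨0, fun k hk => absurd ⟨k, hk⟩ h⟩
  choose c hc using hex
  set z : ℕ → Set X → ℂ :=
    fun k R => ∑ Q ∈ P k, d Q * changeExponent m s β Q (c Q) R with hz
  have hzrep : ∀ k, IsSouzaRep m p q P s (fun x => ∑ Q ∈ P k, d Q * b Q x) (z k) := fun k =>
    hD.isSouzaRep_sum hp hq (P k) fun Q hQ => hD.isSouzaRep_const_mul hp hq
      (isSouzaRep_changeExponent hP hp hsβ (hc Q k hQ).1) (d Q)
  have hl0 : 0 ≤ l₂ ^ (β - s) := Real.rpow_nonneg hP.l₂_pos.le _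
  have hl1 : l₂ ^ (β - s) < 1 := hP.rpow_lt_one (by linarith)
  have hlev : ∀ j k, lpSum p (P j) (fun R => ‖z k R‖ₑ) ≤
      ENNReal.ofReal ((l₂ ^ (β - s)) ^ Nat.dist j k) * (2 * lpSum p (P k) (fun Q => ‖d Q‖ₑ)) := by
    intro j k
    have h1 := lpSum_sum_le_of_unique hp (P j) (P k) (fun Q R => R ⊆ Q)
      (fun R hR Q hQ Q' hQ' h h' => hP.ancestor_unique hR hQ hQ' h h')
      (fun Q => ‖d Q‖ₑ) (fun Q R => ‖changeExponent m s β Q (c Q) R‖ₑ)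
      (ENNReal.ofReal (2 * (l₂ ^ (β - s)) ^ Nat.dist j k)) (fun Q hQ => by
        refine (lpSum_mono hp fun R _ => ?_).trans
          (lpSum_changeExponent_le hP hp hq hsβ hQ (hc Q k hQ).2.1 j)
        split_ifs <;> simp)
    refine (lpSum_mono hp fun R _ => ?_).trans (h1.trans (le_of_eq ?_))
    · refine (enorm_sum_le _ _).trans (Finset.sum_le_sum fun Q _ => ?_)
      rw [enorm_mul]
      split_ifs with h
      · exact le_rfl
      · simp [changeExponent, h]
    · rw [mul_comm 2, ENNReal.ofReal_mul (by positivity), mul_assoc]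
      simp
  have hbound : coefNormE p q P (fun R => ∑' k, ‖z k R‖ₑ) ≤
      ENNReal.ofReal (2 / (1 - l₂ ^ (β - s)) * 2) * coefNorm p q P d := by
    calc _ ≤ eLpNorm (fun j => ∑' k, ENNReal.ofReal ((l₂ ^ (β - s)) ^ Nat.dist j k) *
          (2 * lpSum p (P k) (fun Q => ‖d Q‖ₑ))) q Measure.count :=
          eLpNorm_count_mono fun j => (lpSum_tsum_le hp (P j) fun k R => ‖z k R‖ₑ).trans
            (ENNReal.tsum_le_tsum fun k => hlev j k)
      _ ≤ _ := eLpNorm_count_conv_le _ hl0 hl1 hq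
      _ = _ := by
          rw [eLpNorm_const_mul_ennreal _ _ measurable_from_top.aemeasurable hq, ← mul_assoc,
            ENNReal.ofReal_mul (div_nonneg two_pos.le (by linarith))]
          simp [coefNorm_eq_coefNormE, coefNormE]
  have hfin := hbound.trans_lt (ENNReal.mul_lt_top ENNReal.ofReal_lt_top hrep.coefNorm_lt_top)
  have hf : f =ᵐ[m] fun x => ∑' k, ∑ Q ∈ P k, d Q * b Q x :=
    ae_eq_tsum_of_tendsto (fun k => (hzrep k).memLp.1) hp' hrep.abs_convergent hrep.memLp.1
      hrep.tendsto
  refine ⟨fun R => ∑' k, z k R, hD.isSouzaRep_tsum hp hq hzrep hfin hf, ?_, ?_⟩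
  · exact (coefNormE_mono hp fun _ _ _ => enorm_tsum_le_tsum_enorm).trans hbound
  · intro hd hpos j R hR
    refine tsum_nonneg fun k => Finset.sum_nonneg fun Q hQ => mul_nonneg (hd k Q hQ) ?_
    unfold changeExponent
    split_ifs with h
    · exact mul_nonneg ((hc Q k hQ).2.2 (hpos k Q hQ) j R (mem_gridWithin.2 ⟨hR, h⟩))
        (by exact_mod_cast Real.rpow_nonneg measureReal_nonneg _)
    · exact le_rfl

end Conversion

/-! ## Decomposition of the pulled back sets of a branch -/

section Branch

variable {I J : Type*} {mI : MeasurableSpace I} {mJ : MeasurableSpace J} {m : Measure I}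
  {μ : Measure J} {P : ℕ → Finset (Set I)} {H : ℕ → Finset (Set J)}
  {s p a e cD lD cS lS : ℝ} {G : ℕ → Finset (Set I)} {J' : Set J} {I' : Set I} {h : J' ≃ᵐ I'}

theorem mem_pullback {Q : Set I} {y : J} (hy : y ∈ J') :
    y ∈ pullback h Q ↔ (h ⟨y, hy⟩ : I) ∈ Q :=
  ⟨fun ⟨_, h'⟩ => h', fun h' => ⟨hy, h'⟩⟩

theorem pullback_subset (Q : Set I) : pullback h Q ⊆ J' := fun _ ⟨hy, _⟩ => hy

namespace IsBranch

/-- Nonsingularity is assumed for measurable subsets of the image only, so the exceptional set is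
first enlarged to a measurable null set. -/
theorem ae_pullback (hb : IsBranch m P μ H s p a e cD lD cS lS G h) {A : I → Prop}
    (hA : ∀ᵐ x ∂m, A x) : ∀ᵐ y ∂μ, ∀ hy : y ∈ J', A (h ⟨y, hy⟩) := by
  set N : Set I := toMeasurable m {x | ¬ A x} ∩ I'
  have hN : m N = 0 := measure_mono_null inter_subset_left (by rwa [measure_toMeasurable])
  have hN' : μ (pullback h N) = 0 := (hb.nonsingular N inter_subset_right
    ((measurableSet_toMeasurable _ _).inter hb.measurableSet_im)).1 hN
  refine measure_mono_null (fun y hy => ?_) hN'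
  simp only [mem_compl_iff, mem_ofPred_eq, not_forall] at hy
  obtain ⟨hyJ, hyA⟩ := hy
  exact ⟨hyJ, subset_toMeasurable _ _ hyA, (h ⟨y, hyJ⟩).2⟩

theorem real_pos [IsFiniteMeasure m] (hb : IsBranch m P μ H s p a e cD lD cS lS G h) {j : ℕ}
    {Q : Set I} (hQ : Q ∈ G j) : 0 < m.real Q :=
  ENNReal.toReal_pos (hb.localGrid.measure_pos j Q hQ).ne' (measure_ne_top _ _)

theorem real_pullback_pos [IsFiniteMeasure μ]
    (hb : IsBranch m P μ H s p a e cD lD cS lS G h) {j : ℕ}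
    {Q : Set I} (hQ : Q ∈ G j) (hQI : Q ⊆ I') : 0 < μ.real (pullback h Q) := by
  refine ENNReal.toReal_pos (fun h0 => ?_) (measure_ne_top _ _)
  exact (hb.localGrid.measure_pos j Q hQ).ne'
    ((hb.nonsingular Q hQI (hb.localGrid.measurableSet j Q hQ)).2 h0)

/-- The coefficient estimate behind the decomposition of `h⁻¹(Q)` into sets of level `k ≥ k₀`. -/
theorem scaling_le [IsFiniteMeasure m] [IsFiniteMeasure μ]
    (hb : IsBranch m P μ H s p a e cD lD cS lS G h)
    (hcD : 0 < cD) (hlD : 0 < lD) (hcS : 0 < cS) (hlS : 0 < lS) {cR : ℝ} (hcR : 0 < cR)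
    {ε γ τ L : ℝ} (hε : 0 < ε) (he : |e| = ε) (hγ : 0 < γ) (hγ' : γ ≤ 1)
    (hτS : lS ^ ε ≤ τ) (hτD : lD ^ (1 / p) ≤ τ) (hτ1 : τ < 1) (hτL : τ ≤ L)
    {j : ℕ} {Q : Set I} (hQ : Q ∈ G j) (hQI : Q ⊆ I') {k : ℕ}
    (hk : firstLevel (pullback h Q) H ≤ k) :
    cR * (m.real Q / μ.real (pullback h Q)) ^ e * cD ^ (1 / p) *
        (lD ^ (1 / p)) ^ (k - firstLevel (pullback h Q) H) ≤
      (L ^ γ) ^ Nat.dist k j * (cS ^ ε * cR * cD ^ (1 / p) * τ ^ (a * (1 - γ))) := by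
  set k₀ := firstLevel (pullback h Q) H
  have hlev : firstLevel Q G = j := hb.localGrid.firstLevel_eq j Q hQ hQI
  have hlevel := hb.scaling_level j Q hQ hQI
  have hsize := hb.scaling_size j Q hQ hQI
  rw [hlev] at hlevel hsize
  set n : ℝ := |(j : ℝ) - k₀|
  set ρ := m.real Q / μ.real (pullback h Q)
  have hρ : 0 ≤ ρ := div_nonneg measureReal_nonneg measureReal_nonneg
  have hlDp : 0 < lD ^ (1 / p) := Real.rpow_pos_of_pos hlD _
  have hτ0 : 0 < τ := hlDp.trans_le hτD
  have hL0 : 0 ≤ L := hτ0.le.trans hτL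
  have hn : 0 ≤ n := abs_nonneg _
  have hcast : ((k - k₀ : ℕ) : ℝ) = (k : ℝ) - k₀ := Nat.cast_sub hk
  -- The total exponent t is the level gap n between Q and Q' plus the depth k - k₀ inside Q'. It
  -- dominates a, and the triangle inequality through k₀ gives t ≥ |k - j|.
  set t : ℝ := n + ((k - k₀ : ℕ) : ℝ)
  have hta : a ≤ t := hlevel.trans (by simp [t])
  have htd : ((Nat.dist k j : ℕ) : ℝ) ≤ t := by
    have h1 : (j : ℝ) - k₀ ≤ n := le_abs_self _
    have h2 : -((j : ℝ) - k₀) ≤ n := neg_le_abs _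
    have h3 : (k₀ : ℝ) ≤ k := by exact_mod_cast hk
    rcases le_total k j with hkj | hkj
    · have : Nat.dist k j = j - k := by simp [Nat.dist, hkj]
      rw [this, Nat.cast_sub hkj]
      simp only [t, hcast]
      linarith
    · have : Nat.dist k j = k - j := by simp [Nat.dist, hkj]
      rw [this, Nat.cast_sub hkj]
      simp only [t, hcast]
      linarith
  -- The scaling control bounds the ratio or its inverse, according to the sign of e; raising it to
  -- the power ε = |e| restores the signed exponent.
  have hρe : ρ ^ e ≤ cS ^ ε * τ ^ n := by
    have hene : |e| ≠ 0 := by rw [he]; exact hε.ne'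
    have h1 : ρ ^ e = (ρ ^ (e / |e|)) ^ ε := by
      rw [← Real.rpow_mul hρ, ← he, div_mul_cancel₀ _ hene]
    rw [h1]
    refine (Real.rpow_le_rpow (Real.rpow_nonneg hρ _) hsize hε.le).trans ?_
    rw [Real.mul_rpow hcS.le (Real.rpow_nonneg hlS.le _), ← Real.rpow_mul hlS.le, mul_comm _ ε,
      Real.rpow_mul hlS.le]
    gcongr
  have hτt : τ ^ n * τ ^ (k - k₀) ≤ (L ^ γ) ^ Nat.dist k j * τ ^ (a * (1 - γ)) := by
    rw [← Real.rpow_natCast, ← Real.rpow_add hτ0]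
    -- The share γ of the exponent pays for decay in |k - j|, uniformly in the branch through L; the
    -- share 1 - γ is kept with the branch's own rate and uses t ≥ a.
    have h1 : t = γ * t + t * (1 - γ) := by ring
    change τ ^ t ≤ _
    rw [h1, Real.rpow_add hτ0]
    refine mul_le_mul ?_ ?_ (by positivity) (by positivity)
    · rw [← Real.rpow_natCast, ← Real.rpow_mul hL0]
      calc τ ^ (γ * t) ≤ τ ^ (γ * (Nat.dist k j : ℕ)) :=
            Real.rpow_le_rpow_of_exponent_ge hτ0 hτ1.le (by gcongr)
        _ ≤ _ := Real.rpow_le_rpow hτ0.le hτL (by positivity)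
    · refine Real.rpow_le_rpow_of_exponent_ge hτ0 hτ1.le ?_
      exact mul_le_mul_of_nonneg_right hta (by linarith)
  calc _ ≤ cR * (cS ^ ε * τ ^ n) * cD ^ (1 / p) * τ ^ (k - k₀) := by gcongr
    _ = cS ^ ε * cR * cD ^ (1 / p) * (τ ^ n * τ ^ (k - k₀)) := by ring
    _ ≤ cS ^ ε * cR * cD ^ (1 / p) * ((L ^ γ) ^ Nat.dist k j * τ ^ (a * (1 - γ))) := by gcongr
    _ = _ := by ring

open Classical in
/-- The pulled back set of a member of the local grid is a disjoint union of members of `H`, with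
an estimate for the coefficients of the corresponding atoms. -/
theorem exists_decomposition [IsProbabilityMeasure m] [IsProbabilityMeasure μ] {k₁ k₂ : ℝ}
    (hH : IsGoodGrid μ H k₁ k₂) (hb : IsBranch m P μ H s p a e cD lD cS lS G h) (hp : 1 ≤ p)
    (hcD : 0 < cD) (hlD : 0 < lD) (hcS : 0 < cS) (hlS : 0 < lS) {cR : ℝ} (hcR : 0 < cR)
    {ε γ τ L : ℝ} (hε : 0 < ε) (he : |e| = ε) (hγ : 0 < γ) (hγ' : γ ≤ 1)
    (hτS : lS ^ ε ≤ τ) (hτD : lD ^ (1 / p) ≤ τ) (hτ1 : τ < 1) (hτL : τ ≤ L)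
    {j : ℕ} {Q : Set I} (hQ : Q ∈ G j) (hQI : Q ⊆ I') :
    ∃ E : Set J → Prop,
      (∀ W, E W → (∃ k, W ∈ H k) ∧ W ⊆ pullback h Q) ∧
      (∀ y ∈ pullback h Q, ∃ W, E W ∧ y ∈ W) ∧
      (∀ W W', E W → E W' → ∀ y ∈ W, y ∈ W' → W = W') ∧
      ∀ k, lpSum p (H k) (fun W => if E W then ENNReal.ofReal
          (cR * (m.real Q / μ.real (pullback h Q)) ^ e *
            (μ.real W / μ.real (pullback h Q)) ^ (1 / p - s)) else 0) ≤
        ENNReal.ofReal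
          ((L ^ γ) ^ Nat.dist k j * (cS ^ ε * cR * cD ^ (1 / p) * τ ^ (a * (1 - γ)))) := by
  have hp0 : 0 < p := by linarith
  obtain ⟨F, hFH, hunion, hdisj, hsum⟩ := hb.geometric j Q hQ hQI
  set Ω := pullback h Q with hΩ
  set k₀ := firstLevel Ω H with hk₀
  have hsub : ∀ k ≥ k₀, ∀ W ∈ F k, W ⊆ Ω := by
    intro k hk W hW y hy
    rw [hunion]
    simp only [mem_iUnion]
    exact ⟨k, hk, W, hW, hy⟩
  refine ⟨fun W => ∃ k ≥ k₀, W ∈ F k, ?_, ?_, ?_, ?_⟩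
  · rintro W ⟨k, hk, hW⟩
    exact ⟨⟨k, hFH k hW⟩, hsub k hk W hW⟩
  · intro y hy
    rw [hunion] at hy
    simp only [mem_iUnion] at hy
    obtain ⟨k, hk, W, hW, hyW⟩ := hy
    exact ⟨W, ⟨k, hk, hW⟩, hyW⟩
  · rintro W W' ⟨k, hk, hW⟩ ⟨k', hk', hW'⟩ y hy hy'
    by_contra hne
    exact Set.disjoint_left.1 (hdisj k hk k' hk' W hW W' hW' hne) hy hy'
  · intro k
    rw [lpSum_le_iff hp]
    -- A set has only one level in a good grid, so among members of `H k` the selected ones are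
    -- exactly those of `F k`, and none when k < k₀.
    have hiff : ∀ W ∈ H k, (∃ k' ≥ k₀, W ∈ F k') ↔ k₀ ≤ k ∧ W ∈ F k := by
      intro W hW
      constructor
      · rintro ⟨k', hk', hW'⟩
        obtain rfl := hH.level_unique hW (hFH k' hW')
        exact ⟨hk', hW'⟩
      · exact fun ⟨h1, h2⟩ => ⟨k, h1, h2⟩
    rcases lt_or_ge k k₀ with hlt | hge
    · rw [Finset.sum_eq_zero]
      · exact zero_le
      · intro W hW
        have : ¬ ∃ k' ≥ k₀, W ∈ F k' := by
          rw [hiff W hW]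
          omega
        simp only [if_neg this, ENNReal.zero_rpow_of_pos hp0]
    set ρ := m.real Q / μ.real Ω
    have hρ : 0 ≤ ρ := div_nonneg measureReal_nonneg measureReal_nonneg
    have hΩpos : 0 < μ.real Ω := hb.real_pullback_pos hQ hQI
    -- Raising to the power p turns the exponent 1/p - s into 1 - sp, the exponent of the regular
    -- domain estimate.
    have hterm : ∀ W, (cR * ρ ^ e * (μ.real W / μ.real Ω) ^ (1 / p - s)) ^ p =
        (cR * ρ ^ e) ^ p / μ.real Ω ^ (1 - s * p) * μ.real W ^ (1 - s * p) := by
      intro W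
      have hx : (1 / p - s) * p = 1 - s * p := by field_simp
      rw [Real.mul_rpow (by positivity) (by positivity), ← Real.rpow_mul (by positivity), hx,
        Real.div_rpow (measureReal_nonneg (s := W)) (measureReal_nonneg (s := Ω))]
      ring
    calc _ = ∑ W ∈ F k, ENNReal.ofReal (cR * ρ ^ e * (μ.real W / μ.real Ω) ^ (1 / p - s)) ^ p := by
          rw [← Finset.sum_subset (hFH k)]
          · refine Finset.sum_congr rfl fun W hW => ?_
            simp only [if_pos (show ∃ k' ≥ k₀, W ∈ F k' from ⟨k, hge, hW⟩)]
          · intro W hW hWF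
            have : ¬ ∃ k' ≥ k₀, W ∈ F k' := by
              rw [hiff W hW]
              exact fun h => hWF h.2
            simp only [if_neg this, ENNReal.zero_rpow_of_pos hp0]
      _ = ENNReal.ofReal ((cR * ρ ^ e) ^ p / μ.real Ω ^ (1 - s * p) *
            ∑ W ∈ F k, μ.real W ^ (1 - s * p)) := by
          rw [Finset.mul_sum, ENNReal.ofReal_sum_of_nonneg (fun W _ => by positivity)]
          refine Finset.sum_congr rfl fun W _ => ?_
          rw [ENNReal.ofReal_rpow_of_nonneg (by positivity) hp0.le, hterm]
      _ ≤ ENNReal.ofReal ((cR * ρ ^ e * cD ^ (1 / p) * (lD ^ (1 / p)) ^ (k - k₀)) ^ p) := by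
          refine ENNReal.ofReal_le_ofReal ?_
          have h1 : (cR * ρ ^ e * cD ^ (1 / p) * (lD ^ (1 / p)) ^ (k - k₀)) ^ p =
              (cR * ρ ^ e) ^ p / μ.real Ω ^ (1 - s * p) *
                (cD * lD ^ (k - k₀) * μ.real Ω ^ (1 - s * p)) := by
            have h2 : ((lD ^ (1 / p)) ^ (k - k₀)) ^ p = lD ^ (k - k₀) := by
              rw [← Real.rpow_natCast, ← Real.rpow_mul hlD.le, ← Real.rpow_mul hlD.le,
                ← Real.rpow_natCast]
              congr 1
              field_simp
            have h3 : (cD ^ (1 / p)) ^ p = cD := by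
              rw [← Real.rpow_mul hcD.le, one_div_mul_cancel hp0.ne', Real.rpow_one]
            rw [Real.mul_rpow (by positivity) (by positivity),
              Real.mul_rpow (by positivity) (by positivity), h2, h3]
            have : μ.real Ω ^ (1 - s * p) ≠ 0 := (Real.rpow_pos_of_pos hΩpos _).ne'
            field_simp
          rw [h1]
          exact mul_le_mul_of_nonneg_left (hsum k hge) (by positivity)
      _ ≤ _ := by
          rw [ENNReal.ofReal_rpow_of_nonneg _ hp0.le]
          · refine ENNReal.ofReal_le_ofReal (Real.rpow_le_rpow (by positivity) ?_ hp0.le)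
            exact hb.scaling_le hcD hlD hcS hlS hcR hε he hγ hγ' hτS hτD hτ1 hτL hQ hQI hge
          · have h1 : 0 ≤ τ := (Real.rpow_nonneg hlD.le _).trans hτD
            have h2 : 0 ≤ L := h1.trans hτL
            positivity

end IsBranch

end Branch

/-! ### Coefficients of the transferred series and the two slicing estimates -/

namespace TransferData

variable {I J : Type*} {mI : MeasurableSpace I} {mJ : MeasurableSpace J} {D : TransferData I J}
  {m : Measure I} {μ : Measure J} {P : ℕ → Finset (Set I)} {H : ℕ → Finset (Set J)}
  {p s β ε δ γ : ℝ} {q : ℝ≥0∞}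

/-- The members of the local grid of the branch `r` contained in `I_r`. -/
def localGrid (D : TransferData I J) (r : D.Λ) : ℕ → Finset (Set I) :=
  gridWithin (D.G r) (D.im r)

/-- `Q' = h_r⁻¹(Q)`. -/
def pull (D : TransferData I J) (r : D.Λ) (Q : Set I) : Set J := pullback (D.h r) Q

/-- The coefficient of the Besov atom on `W ⊆ h_r⁻¹(Q)` in the expansion of `Φ_r(a_Q)`. -/
def weight (D : TransferData I J) (m : Measure I) (μ : Measure J) (p s : ℝ) (r : D.Λ) (Q : Set I)
    (W : Set J) : ℝ :=
  D.cR r * (m.real Q / μ.real (D.pull r Q)) ^ D.e r *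
    (μ.real W / μ.real (D.pull r Q)) ^ (1 / p - s)

open Classical in
/-- `E r Q W` selects the members `W` of `H` of a decomposition of `h_r⁻¹(Q)`. -/
structure IsDecomposition (D : TransferData I J) (m : Measure I) (μ : Measure J)
    (H : ℕ → Finset (Set J)) (p s ε γ : ℝ) (E : D.Λ → Set I → Set J → Prop) : Prop where
  mem : ∀ r j, ∀ Q ∈ D.localGrid r j, ∀ W, E r Q W → (∃ k, W ∈ H k) ∧ W ⊆ D.pull r Q
  cover : ∀ r j, ∀ Q ∈ D.localGrid r j, ∀ y ∈ D.pull r Q, ∃ W, E r Q W ∧ y ∈ W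
  eq_of_mem : ∀ r j, ∀ Q ∈ D.localGrid r j, ∀ W W', E r Q W → E r Q W' →
    ∀ y ∈ W, y ∈ W' → W = W'
  lpSum_weight_le : ∀ r j, ∀ Q ∈ D.localGrid r j, ∀ k,
    lpSum p (H k) (fun W => if E r Q W then ENNReal.ofReal (D.weight m μ p s r Q W) else 0) ≤
      ENNReal.ofReal ((D.supRate p ε ^ γ) ^ Nat.dist k j * D.Θ p ε γ r)

namespace IsAdmissible

theorem rate_le_supRate (hD : D.IsAdmissible m P μ H p s q β ε δ) (r : D.Λ) :
    D.rate p ε r ≤ D.supRate p ε :=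
  le_ciSup (f := D.rate p ε) ⟨1, by rintro _ ⟨r, rfl⟩; exact (hD.rate_lt_one r).le⟩ r

theorem supRate_nonneg (hD : D.IsAdmissible m P μ H p s q β ε δ) : 0 ≤ D.supRate p ε :=
  Real.iSup_nonneg fun r => (Real.rpow_nonneg (hD.const_pos r).2.2.2.1.le _).trans
    (le_max_left _ _)

theorem exists_isDecomposition [IsProbabilityMeasure m] [IsProbabilityMeasure μ] {k₁ k₂ : ℝ}
    (hD : D.IsAdmissible m P μ H p s q β ε δ) (hH : IsGoodGrid μ H k₁ k₂) (hp : 1 ≤ p)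
    (hε : 0 < ε) (hγ : 0 < γ) (hγ' : γ ≤ 1) :
    ∃ E, D.IsDecomposition m μ H p s ε γ E := by
  classical
  have key : ∀ (r : D.Λ) (Q : Set I), ∃ E : Set J → Prop, ∀ j, Q ∈ D.localGrid r j →
      (∀ W, E W → (∃ k, W ∈ H k) ∧ W ⊆ D.pull r Q) ∧
      (∀ y ∈ D.pull r Q, ∃ W, E W ∧ y ∈ W) ∧
      (∀ W W', E W → E W' → ∀ y ∈ W, y ∈ W' → W = W') ∧
      ∀ k, lpSum p (H k) (fun W => if E W then ENNReal.ofReal (D.weight m μ p s r Q W) else 0) ≤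
        ENNReal.ofReal ((D.supRate p ε ^ γ) ^ Nat.dist k j * D.Θ p ε γ r) := by
    intro r Q
    by_cases h : ∃ j, Q ∈ D.localGrid r j
    · obtain ⟨j, hj⟩ := h
      obtain ⟨h1, h2, h3, h4, h5⟩ := hD.const_pos r
      obtain ⟨hQ, hQI⟩ := mem_gridWithin.1 hj
      obtain ⟨E, hE⟩ := (hD.branch r).exists_decomposition hH hp h1 h2 h3 h4 h5 hε (hD.abs_e r)
        hγ hγ' (le_max_left _ _ : _ ≤ D.rate p ε r) (le_max_right _ _) (hD.rate_lt_one r)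
        (hD.rate_le_supRate r) hQ hQI
      refine ⟨E, fun j' hj' => ?_⟩
      -- The level of Q is its own first level, so one choice of decomposition serves every level at
      -- which Q occurs.
      obtain rfl : j' = j := by
        obtain ⟨hQ', _⟩ := mem_gridWithin.1 hj'
        rw [← (hD.branch r).localGrid.firstLevel_eq j Q hQ hQI,
          (hD.branch r).localGrid.firstLevel_eq j' Q hQ' hQI]
      exact hE
    · exact ⟨fun _ => False, fun j hj => absurd ⟨j, hj⟩ h⟩
  choose E hE using key
  exact ⟨E, fun r j Q hQ => (hE r Q j hQ).1, fun r j Q hQ => (hE r Q j hQ).2.1,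
    fun r j Q hQ => (hE r Q j hQ).2.2.1, fun r j Q hQ => (hE r Q j hQ).2.2.2⟩

end IsAdmissible

open Classical in
/-- The contribution of the level `j` of the local grid of `r` to the coefficient of `W`. -/
def levelCoef (D : TransferData I J) (m : Measure I) (μ : Measure J) (p s : ℝ)
    (E : D.Λ → Set I → Set J → Prop) (c : D.Λ → Set I → ℂ) (r : D.Λ) (j : ℕ) (W : Set J) :
    ℝ≥0∞ :=
  ∑ Q ∈ D.localGrid r j,
    if E r Q W then ‖c r Q‖ₑ * ENNReal.ofReal (D.weight m μ p s r Q W) else 0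

/-- The coefficient of the Besov atom on `W` in the expansion of `Φ(f)`. -/
def totalCoef (D : TransferData I J) (m : Measure I) (μ : Measure J) (p s : ℝ)
    (E : D.Λ → Set I → Set J → Prop) (c : D.Λ → Set I → ℂ) (W : Set J) : ℝ≥0∞ :=
  ∑' r, ∑' j, D.levelCoef m μ p s E c r j W

open Classical in
/-- The value of `∑ c_Q a_Q` on `h_r(W)`, where `Q` runs over the members of level `j` of the local
grid of `r` whose decomposition contains `W`. -/
def levelValue (D : TransferData I J) (m : Measure I) (p s : ℝ)
    (E : D.Λ → Set I → Set J → Prop) (c : D.Λ → Set I → ℂ) (r : D.Λ) (j : ℕ) (W : Set J) : ℂ :=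
  ∑ Q ∈ D.localGrid r j, if E r Q W then c r Q * ((m.real Q ^ (s - 1 / p) : ℝ) : ℂ) else 0

namespace IsDecomposition

variable {E : D.Λ → Set I → Set J → Prop} {c : D.Λ → Set I → ℂ} {k₁ k₂ : ℝ}

theorem eq_of_mem_pull (hD : D.IsAdmissible m P μ H p s q β ε δ) {r : D.Λ} {j : ℕ}
    {Q Q' : Set I} (hQ : Q ∈ D.localGrid r j) (hQ' : Q' ∈ D.localGrid r j) {y : J}
    (h : y ∈ D.pull r Q) (h' : y ∈ D.pull r Q') : Q = Q' := by
  obtain ⟨hy, hyQ⟩ := h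
  obtain ⟨_, hyQ'⟩ := h'
  by_contra hne
  obtain ⟨h1, h2⟩ := mem_gridWithin.1 hQ
  obtain ⟨h3, h4⟩ := mem_gridWithin.1 hQ'
  exact Set.disjoint_left.1 ((hD.branch r).localGrid.disjoint j Q h1 Q' h3 h2 h4 hne) hyQ hyQ'

theorem unique [IsProbabilityMeasure μ] (hE : D.IsDecomposition m μ H p s ε γ E)
    (hD : D.IsAdmissible m P μ H p s q β ε δ) (hH : IsGoodGrid μ H k₁ k₂) {r : D.Λ} {j k : ℕ}
    {W : Set J} (hW : W ∈ H k) {Q Q' : Set I} (hQ : Q ∈ D.localGrid r j)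
    (hQ' : Q' ∈ D.localGrid r j) (h : E r Q W) (h' : E r Q' W) : Q = Q' := by
  obtain ⟨y, hy⟩ := hH.nonempty hW
  exact eq_of_mem_pull hD hQ hQ' ((hE.mem r j Q hQ W h).2 hy) ((hE.mem r j Q' hQ' W h').2 hy)

/-- The pulled back sets of one level of the local grid are disjoint, so each W is selected by at
most one Q and the weight bound passes to the whole level unchanged. -/
theorem lpSum_levelCoef_le [IsProbabilityMeasure μ] (hE : D.IsDecomposition m μ H p s ε γ E)
    (hD : D.IsAdmissible m P μ H p s q β ε δ) (hH : IsGoodGrid μ H k₁ k₂) (hp : 1 ≤ p)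
    (r : D.Λ) (j k : ℕ) :
    lpSum p (H k) (D.levelCoef m μ p s E c r j) ≤
      ENNReal.ofReal ((D.supRate p ε ^ γ) ^ Nat.dist k j) *
        (ENNReal.ofReal (D.Θ p ε γ r) * lpSum p (D.localGrid r j) (fun Q => ‖c r Q‖ₑ)) := by
  classical
  have h := lpSum_sum_le_of_unique hp (H k) (D.localGrid r j) (fun Q W => E r Q W)
    (fun W hW Q hQ Q' hQ' h h' => hE.unique hD hH hW hQ hQ' h h') (fun Q => ‖c r Q‖ₑ)
    (fun Q W => ENNReal.ofReal (D.weight m μ p s r Q W)) _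
    (fun Q hQ => hE.lpSum_weight_le r j Q hQ k)
  have h0 : 0 ≤ (D.supRate p ε ^ γ) ^ Nat.dist k j :=
    pow_nonneg (Real.rpow_nonneg hD.supRate_nonneg _) _
  rw [ENNReal.ofReal_mul h0, mul_assoc] at h
  exact h

variable [IsProbabilityMeasure μ]

/-- Minkowski's inequality is applied over both branches and levels; the remaining sum over levels
is a convolution. -/
theorem coefNormE_totalCoef_le₁ (hE : D.IsDecomposition m μ H p s ε γ E)
    (hD : D.IsAdmissible m P μ H p s q β ε δ) (hH : IsGoodGrid μ H k₁ k₂) (hp : 1 ≤ p)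
    (hq : 1 ≤ q) (hγ : 0 < γ) :
    coefNormE p q H (D.totalCoef m μ p s E c) ≤
      ENNReal.ofReal (2 / (1 - D.supRate p ε ^ γ)) * D.slicingNorm₁ p q ε γ c := by
  refine le_trans (eLpNorm_count_mono fun k => ?_) (eLpNorm_count_conv_le
    (fun j : ℕ => ∑' r, ENNReal.ofReal (D.Θ p ε γ r) *
      (∑ Q ∈ gridWithin (D.G r) (D.im r) j, ‖c r Q‖ₑ ^ p) ^ (1 / p))
    (Real.rpow_nonneg hD.supRate_nonneg _)
    (Real.rpow_lt_one hD.supRate_nonneg hD.supRate_lt_one hγ) hq)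
  calc _ ≤ ∑' r, ∑' j, lpSum p (H k) (D.levelCoef m μ p s E c r j) :=
        (lpSum_tsum_le hp (H k) _).trans
          (ENNReal.tsum_le_tsum fun r => lpSum_tsum_le hp (H k) _)
    _ = ∑' j, ∑' r, lpSum p (H k) (D.levelCoef m μ p s E c r j) := ENNReal.tsum_comm
    _ ≤ _ := by
        refine ENNReal.tsum_le_tsum fun j => ?_
        rw [← ENNReal.tsum_mul_left]
        exact ENNReal.tsum_le_tsum fun r => hE.lpSum_levelCoef_le hD hH hp r j k

/-- Minkowski is used only over levels. For a fixed level, at most N branches contribute to a given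
W, so a power mean keeps the ℓ^p sum over branches at the cost N^{1-1/p}. -/
theorem coefNormE_totalCoef_le₂ (hE : D.IsDecomposition m μ H p s ε γ E)
    (hD : D.IsAdmissible m P μ H p s q β ε δ) (hH : IsGoodGrid μ H k₁ k₂) (hp : 1 ≤ p)
    (hq : 1 ≤ q) (hγ : 0 < γ) :
    coefNormE p q H (D.totalCoef m μ p s E c) ≤
      ENNReal.ofReal (2 / (1 - D.supRate p ε ^ γ)) * D.slicingNorm₂ H p q ε γ c := by
  have hp0 : 0 < p := by linarith
  set N : ℝ≥0∞ := (D.overlap H : ℝ≥0∞)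
  set v : ℕ → ℝ≥0∞ := fun j => (∑' r, ENNReal.ofReal (D.Θ p ε γ r) ^ p *
    ∑ Q ∈ gridWithin (D.G r) (D.im r) j, ‖c r Q‖ₑ ^ p) ^ (1 / p)
  -- A nonzero contribution of r to W forces W ⊆ h_r⁻¹(Q) ⊆ J_r for some Q.
  have hover : ∀ k, ∀ W ∈ H k, ∀ j,
      {r | D.levelCoef m μ p s E c r j W ≠ 0}.encard ≤ D.overlap H := by
    intro k W hW j
    refine le_trans (encard_le_encard fun r hr => ?_)
      (le_iSup_of_le k (le_iSup₂_of_le W hW le_rfl))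
    obtain ⟨Q, hQ, hne⟩ := Finset.exists_ne_zero_of_sum_ne_zero hr
    have hEW : E r Q W := by
      by_contra h
      simp [h] at hne
    exact ((hE.mem r j Q hQ W hEW).2).trans (pullback_subset Q)
  have hlev : ∀ k j, lpSum p (H k) (fun W => ∑' r, D.levelCoef m μ p s E c r j W) ≤
      ENNReal.ofReal ((D.supRate p ε ^ γ) ^ Nat.dist k j) * (N ^ (1 - 1 / p) * v j) := by
    intro k j
    rw [lpSum_le_iff hp]
    set x := ENNReal.ofReal ((D.supRate p ε ^ γ) ^ Nat.dist k j)
    calc _ ≤ ∑ W ∈ H k, N ^ (p - 1) * ∑' r, D.levelCoef m μ p s E c r j W ^ p :=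
          Finset.sum_le_sum fun W hW => tsum_rpow_le_of_encard_le hp _ (hover k W hW j)
      _ = N ^ (p - 1) * ∑' r, lpSum p (H k) (D.levelCoef m μ p s E c r j) ^ p := by
          rw [← Finset.mul_sum, ← Summable.tsum_finsetSum fun _ _ => ENNReal.summable]
          simp only [lpSum_rpow hp]
      _ ≤ N ^ (p - 1) * ∑' r, (x * (ENNReal.ofReal (D.Θ p ε γ r) *
            lpSum p (D.localGrid r j) (fun Q => ‖c r Q‖ₑ))) ^ p := by
          gcongr with r
          exact hE.lpSum_levelCoef_le hD hH hp r j k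
      _ = (x * (N ^ (1 - 1 / p) * v j)) ^ p := by
          simp only [ENNReal.mul_rpow_of_nonneg _ _ hp0.le, lpSum_rpow hp]
          rw [ENNReal.tsum_mul_left, ← ENNReal.rpow_mul, ← ENNReal.rpow_mul,
            one_div_mul_cancel hp0.ne', ENNReal.rpow_one,
            show (1 - 1 / p) * p = p - 1 by field_simp]
          simp only [localGrid]
          ring
  refine le_trans (eLpNorm_count_mono fun k => ?_) ((eLpNorm_count_conv_le
    (fun j : ℕ => N ^ (1 - 1 / p) * v j) (Real.rpow_nonneg hD.supRate_nonneg _)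
    (Real.rpow_lt_one hD.supRate_nonneg hD.supRate_lt_one hγ) hq).trans (le_of_eq ?_))
  · have htot : D.totalCoef m μ p s E c = fun W => ∑' j, ∑' r, D.levelCoef m μ p s E c r j W :=
      funext fun W => ENNReal.tsum_comm
    rw [htot]
    exact (lpSum_tsum_le hp (H k) _).trans (ENNReal.tsum_le_tsum fun j => hlev k j)
  · rw [eLpNorm_const_mul_ennreal _ _ measurable_from_top.aemeasurable hq]
    rfl

end IsDecomposition

end TransferData

/-! ### Merging contributions into Besov atoms and expanding Φ(f) -/

theorem enorm_inv_toReal_mul_le {t : ℝ≥0∞} (ht : t ≠ ∞) : ‖((t.toReal : ℝ) : ℂ)⁻¹‖ₑ * t ≤ 1 := by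
  -- For t = 0 the inverse is 0 and the product is 0, hence an inequality instead of an equality.
  rcases eq_or_ne t 0 with rfl | h0
  · simp
  have hpos : 0 < t.toReal := ENNReal.toReal_pos h0 ht
  have h1 : ‖((t.toReal : ℝ) : ℂ)‖ₑ = t := by
    rw [← ofReal_norm, Complex.norm_real, Real.norm_of_nonneg hpos.le, ENNReal.ofReal_toReal ht]
  rw [enorm_inv (by exact_mod_cast hpos.ne'), h1, ENNReal.inv_mul_cancel h0 ht]

/-- This passes from the order branch, local level, then W, which comes from expanding each Φ_r(f),
to the order by W needed for an atomic representation. The hypothesis is the absolute convergence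
that each exchange requires. -/
theorem tsum_rearrange {ρ α : Type*} (S : ℕ → Finset α) (w : ρ → ℕ → α → ℂ)
    (h : ∑' k, ∑ a ∈ S k, ∑' r, ∑' j, ‖w r j a‖ₑ < ∞) :
    ∑' r, ∑' j, ∑' k, ∑ a ∈ S k, w r j a = ∑' k, ∑ a ∈ S k, ∑' r, ∑' j, w r j a := by
  have h3 : ∑' r, ∑' j, ∑' k, ∑ a ∈ S k, ‖w r j a‖ₑ < ∞ := by
    refine lt_of_le_of_lt (le_of_eq ?_) h
    calc _ = ∑' r, ∑' k, ∑ a ∈ S k, ∑' j, ‖w r j a‖ₑ := by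
          refine tsum_congr fun r => ?_
          rw [ENNReal.tsum_comm]
          exact tsum_congr fun k => Summable.tsum_finsetSum fun _ _ => ENNReal.summable
      _ = _ := by
          rw [ENNReal.tsum_comm]
          exact tsum_congr fun k => Summable.tsum_finsetSum fun _ _ => ENNReal.summable
  have h4 : ∑' r, ∑' j, ∑' k, ‖∑ a ∈ S k, w r j a‖ₑ < ∞ :=
    lt_of_le_of_lt (ENNReal.tsum_le_tsum fun r => ENNReal.tsum_le_tsum fun j =>
      ENNReal.tsum_le_tsum fun k => enorm_sum_le _ _) h3
  calc _ = ∑' r, ∑' k, ∑' j, ∑ a ∈ S k, w r j a :=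
        tsum_congr fun r => tsum_comm_of_enorm _ ((ENNReal.le_tsum r).trans_lt h4)
    _ = ∑' k, ∑' r, ∑' j, ∑ a ∈ S k, w r j a := by
        refine tsum_comm_of_enorm _ (lt_of_le_of_lt (ENNReal.tsum_le_tsum fun r => ?_) h4)
        rw [ENNReal.tsum_comm (f := fun j k => ‖∑ a ∈ S k, w r j a‖ₑ)]
        exact ENNReal.tsum_le_tsum fun k => enorm_tsum_le_tsum_enorm
    _ = _ := by
        refine tsum_congr fun k => ?_
        have hk : ∀ a ∈ S k, ∑' r, ∑' j, ‖w r j a‖ₑ < ∞ := fun a ha =>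
          ((Finset.single_le_sum (f := fun a => ∑' r, ∑' j, ‖w r j a‖ₑ)
            (fun _ _ => zero_le) ha).trans (ENNReal.le_tsum k)).trans_lt h
        calc _ = ∑' r, ∑ a ∈ S k, ∑' j, w r j a :=
              tsum_congr fun r => Summable.tsum_finsetSum fun a ha =>
                Summable.of_enorm ((ENNReal.le_tsum r).trans_lt (hk a ha)).ne
          _ = _ := Summable.tsum_finsetSum fun a ha => Summable.of_enorm
              ((ENNReal.tsum_le_tsum fun r => enorm_tsum_le_tsum_enorm).trans_lt (hk a ha)).ne

namespace TransferData

variable {I J : Type*} {mI : MeasurableSpace I} {mJ : MeasurableSpace J} {D : TransferData I J}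
  {m : Measure I} {μ : Measure J} {P : ℕ → Finset (Set I)} {H : ℕ → Finset (Set J)}
  {p s β ε δ γ : ℝ} {q : ℝ≥0∞}

/-- The part of the expansion of `Φ(f)` carried by `W`. -/
def block (D : TransferData I J) (m : Measure I) (p s : ℝ)
    (E : D.Λ → Set I → Set J → Prop) (c : D.Λ → Set I → ℂ) (W : Set J) (y : J) : ℂ :=
  ∑' r, (∑' j, D.levelValue m p s E c r j W) * potentialOn (D.g r) W y

/-- The Besov atom on `W` in the expansion of `Φ(f)`. -/
def blockAtom (D : TransferData I J) (m : Measure I) (μ : Measure J) (p s : ℝ)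
    (E : D.Λ → Set I → Set J → Prop) (c : D.Λ → Set I → ℂ) (W : Set J) (y : J) : ℂ :=
  (((D.totalCoef m μ p s E c W).toReal : ℝ) : ℂ)⁻¹ * D.block m p s E c W y

/-- The sum of the absolute values of all terms of the expansion of `Φ(f)` carried by `W`. -/
def absBlock (D : TransferData I J) (m : Measure I) (p s : ℝ)
    (E : D.Λ → Set I → Set J → Prop) (c : D.Λ → Set I → ℂ) (W : Set J) (y : J) : ℝ≥0∞ :=
  ∑' r, ∑' j, ‖D.levelValue m p s E c r j W‖ₑ * ‖potentialOn (D.g r) W y‖ₑ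

namespace IsDecomposition

variable {E : D.Λ → Set I → Set J → Prop} {c : D.Λ → Set I → ℂ} {k₁ k₂ : ℝ}

theorem exists_of_levelValue_ne_zero {r : D.Λ} {j : ℕ} {W : Set J}
    (h : D.levelValue m p s E c r j W ≠ 0) : ∃ Q ∈ D.localGrid r j, E r Q W := by
  classical
  obtain ⟨Q, hQ, hne⟩ := Finset.exists_ne_zero_of_sum_ne_zero h
  refine ⟨Q, hQ, ?_⟩
  by_contra h'
  simp [h'] at hne

theorem levelValue_nonneg {r : D.Λ} (hc : NonnegCoef (D.localGrid r) (c r)) (j : ℕ) (W : Set J) :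
    0 ≤ D.levelValue m p s E c r j W := by
  classical
  refine Finset.sum_nonneg fun Q hQ => ?_
  split_ifs
  · exact mul_nonneg (hc j Q hQ) (by exact_mod_cast Real.rpow_nonneg measureReal_nonneg _)
  · exact le_rfl

/-- The term of `W`, `r` and level `j` in the expansion of `Φ(f)` is measurable, even if the
potential is not. -/
theorem aemeasurable_term (hE : D.IsDecomposition m μ H p s ε γ E)
    (hD : D.IsAdmissible m P μ H p s q β ε δ) {k : ℕ} {W : Set J} (hW : W ∈ H k) (r : D.Λ)
    (j : ℕ) :
    AEMeasurable
      (fun y => ‖D.levelValue m p s E c r j W‖ₑ * ‖potentialOn (D.g r) W y‖ₑ) μ := by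
  -- A nonzero value comes from some Q whose decomposition contains W. The finite Besov norm of the
  -- potential on W then yields a representation, hence measurability.
  by_cases h : D.levelValue m p s E c r j W = 0
  · simp [h]
  · obtain ⟨Q, hQ, hEW⟩ := exists_of_levelValue_ne_zero h
    obtain ⟨hQ1, hQ2⟩ := mem_gridWithin.1 hQ
    have hlt := (hD.potential r k W hW j Q hQ1 hQ2 (hE.mem r j Q hQ W hEW).2).trans_lt
      ENNReal.ofReal_lt_top
    obtain ⟨d, hd, _⟩ := exists_isSouzaRep_of_besovNorm_lt hlt
    exact hd.memLp.1.enorm.const_mul _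

theorem aemeasurable_absBlock (hE : D.IsDecomposition m μ H p s ε γ E)
    (hD : D.IsAdmissible m P μ H p s q β ε δ) {k : ℕ} {W : Set J} (hW : W ∈ H k) :
    AEMeasurable (D.absBlock m p s E c W) μ :=
  aemeasurable_tsum_ennreal fun r => aemeasurable_tsum_ennreal fun j =>
    hE.aemeasurable_term hD hW r j

theorem absBlock_eq_zero {W : Set J} {y : J} (hy : y ∉ W) : D.absBlock m p s E c W y = 0 := by
  simp [absBlock, potentialOn, hy]

variable [IsProbabilityMeasure μ]

/-- The height of a_Q times the bound for the potential on W is the norm allowed to an atom on W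
times the weight; this dictates the form of `weight`. -/
theorem weight_identity [IsProbabilityMeasure m] (hD : D.IsAdmissible m P μ H p s q β ε δ)
    (hH : IsGoodGrid μ H k₁ k₂) {r : D.Λ} {j k : ℕ} {Q : Set I} (hQ : Q ∈ D.localGrid r j)
    {W : Set J} (hW : W ∈ H k) :
    m.real Q ^ (s - 1 / p) * potentialBound m μ s p β (D.e r) (D.cR r) (D.h r) Q W =
      μ.real W ^ (s - β) * D.weight m μ p s r Q W := by
  obtain ⟨hQ1, hQ2⟩ := mem_gridWithin.1 hQ
  have h1 : 0 < m.real Q := (hD.branch r).real_pos hQ1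
  have h2 : 0 < μ.real (pullback (D.h r) Q) := (hD.branch r).real_pullback_pos hQ1 hQ2
  have h3 : 0 < μ.real W := hH.real_pos hW
  simp only [potentialBound, weight, pull]
  rw [Real.rpow_add (div_pos h1 h2), Real.div_rpow h1.le h2.le (1 / p - s),
    Real.div_rpow h3.le h2.le, show s - 1 / p = -(1 / p - s) by ring, Real.rpow_neg h1.le,
    show 1 / p - β = (s - β) + (1 / p - s) by ring, Real.rpow_add h3]
  have h4 := (Real.rpow_pos_of_pos h1 (1 / p - s)).ne'
  field_simp

/-- M is left free so that the estimate serves both for the Besov norm of g_r 1_W and for the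
coefficient norm of its nonnegative representation. -/
theorem enorm_levelValue_mul_le [IsProbabilityMeasure m] (hE : D.IsDecomposition m μ H p s ε γ E)
    (hD : D.IsAdmissible m P μ H p s q β ε δ) (hH : IsGoodGrid μ H k₁ k₂) {r : D.Λ} {j k : ℕ}
    {W : Set J} (hW : W ∈ H k) {M : ℝ≥0∞}
    (hM : ∀ i, ∀ Q ∈ D.G r i, Q ⊆ D.im r → W ⊆ pullback (D.h r) Q →
      M ≤ ENNReal.ofReal (potentialBound m μ s p β (D.e r) (D.cR r) (D.h r) Q W)) :
    ‖D.levelValue m p s E c r j W‖ₑ * M ≤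
      ENNReal.ofReal (μ.real W ^ (s - β)) * D.levelCoef m μ p s E c r j W := by
  classical
  refine (mul_le_mul_left (enorm_sum_le _ _) M).trans ?_
  rw [levelCoef, Finset.sum_mul, Finset.mul_sum]
  refine Finset.sum_le_sum fun Q hQ => ?_
  obtain ⟨hQ1, hQ2⟩ := mem_gridWithin.1 hQ
  split_ifs with h
  · have hM' := hM j Q hQ1 hQ2 (hE.mem r j Q hQ W h).2
    rw [enorm_mul, mul_assoc, mul_left_comm (ENNReal.ofReal _)]
    refine mul_le_mul_right ?_ _
    rw [← ofReal_norm, Complex.norm_real, Real.norm_of_nonneg (by positivity),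
      ← ENNReal.ofReal_mul (by positivity), ← weight_identity (β := β) hD hH hQ hW,
      ENNReal.ofReal_mul (by positivity)]
    gcongr
  · simp

theorem enorm_tsum_levelValue_mul_le [IsProbabilityMeasure m]
    (hE : D.IsDecomposition m μ H p s ε γ E)
    (hD : D.IsAdmissible m P μ H p s q β ε δ) (hH : IsGoodGrid μ H k₁ k₂) {r : D.Λ} {k : ℕ}
    {W : Set J} (hW : W ∈ H k) {M : ℝ≥0∞}
    (hM : ∀ i, ∀ Q ∈ D.G r i, Q ⊆ D.im r → W ⊆ pullback (D.h r) Q →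
      M ≤ ENNReal.ofReal (potentialBound m μ s p β (D.e r) (D.cR r) (D.h r) Q W)) :
    ‖∑' j, D.levelValue m p s E c r j W‖ₑ * M ≤
      ENNReal.ofReal (μ.real W ^ (s - β)) * ∑' j, D.levelCoef m μ p s E c r j W := by
  rw [← ENNReal.tsum_mul_left]
  refine (mul_le_mul_left enorm_tsum_le_tsum_enorm M).trans ?_
  rw [← ENNReal.tsum_mul_right]
  exact ENNReal.tsum_le_tsum fun j => hE.enorm_levelValue_mul_le hD hH hW hM

/-- By subadditivity the block on W has norm at most |W|^{s-β} times its total coefficient, and the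
normalisation removes that coefficient. -/
theorem isBesovAtom_blockAtom [IsProbabilityMeasure m] (hE : D.IsDecomposition m μ H p s ε γ E)
    (hD : D.IsAdmissible m P μ H p s q β ε δ) (hH : IsGoodGrid μ H k₁ k₂) (hp : 1 ≤ p)
    (hq : 1 ≤ q) (hβ : 0 < β) {k : ℕ} {W : Set J} (hW : W ∈ H k)
    (hfin : D.totalCoef m μ p s E c W ≠ ∞) :
    IsBesovAtom μ p q H s β W (D.blockAtom m μ p s E c W) := by
  have hG := hH.isDecayingGrid_within hβ hW
  calc _ ≤ ‖(((D.totalCoef m μ p s E c W).toReal : ℝ) : ℂ)⁻¹‖ₑ *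
        besovNorm μ p q (gridWithin H W) β (D.block m p s E c W) :=
        hG.besovNorm_const_mul_le hp hq _ _
    _ ≤ ‖(((D.totalCoef m μ p s E c W).toReal : ℝ) : ℂ)⁻¹‖ₑ *
        (ENNReal.ofReal (μ.real W ^ (s - β)) * D.totalCoef m μ p s E c W) := by
        gcongr
        refine (hG.besovNorm_tsum_le hp hq (ae_eq_refl _)).trans ?_
        rw [totalCoef, ← ENNReal.tsum_mul_left]
        refine ENNReal.tsum_le_tsum fun r => (hG.besovNorm_const_mul_le hp hq _ _).trans ?_
        exact hE.enorm_tsum_levelValue_mul_le hD hH hW fun i Q hQ hQI hWQ =>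
          hD.potential r k W hW i Q hQ hQI hWQ
    _ ≤ _ := by
        rw [mul_left_comm]
        exact mul_le_of_le_one_right zero_le (enorm_inv_toReal_mul_le hfin)

theorem isPositiveBesovAtom_blockAtom [IsProbabilityMeasure m]
    (hE : D.IsDecomposition m μ H p s ε γ E)
    (hD : D.IsAdmissible m P μ H p s q β ε δ) (hH : IsGoodGrid μ H k₁ k₂) (hp : 1 ≤ p)
    (hq : 1 ≤ q) (hβ : 0 < β) {k : ℕ} {W : Set J} (hW : W ∈ H k)
    (hfin : D.totalCoef m μ p s E c W ≠ ∞)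
    (hpos : D.HasPositivePotentials m μ H p s q β)
    (hc : ∀ r, NonnegCoef (D.localGrid r) (c r)) :
    IsPositiveBesovAtom μ p q H s β W (D.blockAtom m μ p s E c W) := by
  classical
  refine ⟨hE.isBesovAtom_blockAtom hD hH hp hq hβ hW hfin, ?_⟩
  have hG := hH.isDecayingGrid_within hβ hW
  have hex : ∀ r, ∃ z, IsSouzaRep μ p q (gridWithin H W) β
      (fun y => (∑' j, D.levelValue m p s E c r j W) * potentialOn (D.g r) W y) z ∧
      NonnegCoef (gridWithin H W) z ∧ coefNorm p q (gridWithin H W) z ≤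
        ENNReal.ofReal (μ.real W ^ (s - β)) * ∑' j, D.levelCoef m μ p s E c r j W := by
    intro r
    -- Positivity provides a representation only when W ⊆ J_r. Otherwise no decomposition of r
    -- contains W, its values on W vanish, and zero coefficients suffice.
    by_cases hWr : W ⊆ D.dom r
    · obtain ⟨z, hz, hz0, hzn⟩ := hpos r k W hW hWr
      refine ⟨_, hG.isSouzaRep_const_mul hp hq hz _, fun i R hR => mul_nonneg
        (tsum_nonneg fun j => levelValue_nonneg (hc r) j W) (hz0 i R hR), ?_⟩
      rw [coefNorm_const_mul hp hq]
      exact hE.enorm_tsum_levelValue_mul_le hD hH hW hzn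
    · have h0 : ∀ j, D.levelValue m p s E c r j W = 0 := by
        intro j
        by_contra h
        obtain ⟨Q, hQ, hEW⟩ := exists_of_levelValue_ne_zero h
        exact hWr ((hE.mem r j Q hQ W hEW).2.trans (pullback_subset Q))
      simp only [h0, tsum_zero, zero_mul]
      refine ⟨_, hG.isSouzaRep_zero hp hq, fun _ _ _ => le_rfl, ?_⟩
      have := coefNorm_const_mul (P := gridWithin H W) hp hq 0 (fun _ => 0)
      simp only [mul_zero, enorm_zero, zero_mul] at this
      rw [this]
      exact zero_le
  choose z hz hz0 hzn using hex
  have hle : ∑' r, coefNorm p q (gridWithin H W) (z r) ≤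
      ENNReal.ofReal (μ.real W ^ (s - β)) * D.totalCoef m μ p s E c W := by
    rw [totalCoef, ← ENNReal.tsum_mul_left]
    exact ENNReal.tsum_le_tsum hzn
  have hrep := hG.isSouzaRep_tsum hp hq hz
    ((coefNormE_tsum_le hp hq fun r Q => ‖z r Q‖ₑ).trans_lt
      (hle.trans_lt (ENNReal.mul_lt_top ENNReal.ofReal_lt_top hfin.lt_top)))
    (F := D.block m p s E c W) (ae_eq_refl _)
  refine ⟨_, hG.isSouzaRep_const_mul hp hq hrep _, fun i R hR => mul_nonneg ?_
    (tsum_nonneg fun r => hz0 r i R hR), ?_⟩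
  · rw [← Complex.ofReal_inv]
    exact_mod_cast inv_nonneg.2 ENNReal.toReal_nonneg
  · rw [coefNorm_const_mul hp hq]
    calc _ ≤ ‖(((D.totalCoef m μ p s E c W).toReal : ℝ) : ℂ)⁻¹‖ₑ *
          (ENNReal.ofReal (μ.real W ^ (s - β)) * D.totalCoef m μ p s E c W) := by
          gcongr
          exact (coefNorm_tsum_le hp hq z).trans hle
      _ ≤ _ := by
          rw [mul_left_comm]
          exact mul_le_of_le_one_right zero_le (enorm_inv_toReal_mul_le hfin)

/-- Functions in B^β(W) gain |W|^β in L^p. Together with the atom normalisation |W|^{s-β} this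
leaves |W|^s, which is summable over levels. -/
theorem eLpNorm_term_le [IsProbabilityMeasure m] (hE : D.IsDecomposition m μ H p s ε γ E)
    (hD : D.IsAdmissible m P μ H p s q β ε δ) (hH : IsGoodGrid μ H k₁ k₂) (hp : 1 ≤ p)
    (hq : 1 ≤ q) (hβ : 0 < β) {k : ℕ} {W : Set J} (hW : W ∈ H k) (r : D.Λ) (j : ℕ) :
    eLpNorm (fun y => ‖D.levelValue m p s E c r j W‖ₑ * ‖potentialOn (D.g r) W y‖ₑ)
      (ENNReal.ofReal p) μ ≤
      ENNReal.ofReal (μ.real W ^ s * (1 - k₂ ^ β)⁻¹) * D.levelCoef m μ p s E c r j W := by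
  have hp' : 1 ≤ ENNReal.ofReal p := by simpa using hp
  have hWpos := hH.real_pos hW
  by_cases h : D.levelValue m p s E c r j W = 0
  · simp [h]
  have hmeas : AEMeasurable (fun y => ‖potentialOn (D.g r) W y‖ₑ) μ := by
    have h0 : ‖D.levelValue m p s E c r j W‖ₑ ≠ 0 := by simpa using h
    have := (hE.aemeasurable_term (c := c) hD hW r j).const_mul
      (‖D.levelValue m p s E c r j W‖ₑ)⁻¹
    simpa only [← mul_assoc, ENNReal.inv_mul_cancel h0 enorm_ne_top, one_mul] using this
  rw [eLpNorm_const_mul_ennreal _ _ hmeas hp', eLpNorm_enorm]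
  calc _ ≤ ‖D.levelValue m p s E c r j W‖ₑ *
        (ENNReal.ofReal (μ.real W ^ β * (1 - k₂ ^ β)⁻¹) *
          besovNorm μ p q (gridWithin H W) β (potentialOn (D.g r) W)) := by
        gcongr
        exact hH.eLpNorm_le_besovNorm_within hp hq hβ hW _
    _ ≤ ENNReal.ofReal (μ.real W ^ β * (1 - k₂ ^ β)⁻¹) *
        (ENNReal.ofReal (μ.real W ^ (s - β)) * D.levelCoef m μ p s E c r j W) := by
        rw [mul_left_comm]
        refine mul_le_mul_right ?_ _
        exact hE.enorm_levelValue_mul_le hD hH hW fun i Q hQ hQI hWQ =>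
          hD.potential r k W hW i Q hQ hQI hWQ
    _ = _ := by
        have h1 : 0 ≤ (1 - k₂ ^ β)⁻¹ := by
          rw [inv_nonneg]
          linarith [hH.rpow_lt_one hβ]
        rw [← mul_assoc, ← ENNReal.ofReal_mul (by positivity), mul_right_comm,
          ← Real.rpow_add hWpos, add_sub_cancel]

theorem eLpNorm_absBlock_le [IsProbabilityMeasure m] (hE : D.IsDecomposition m μ H p s ε γ E)
    (hD : D.IsAdmissible m P μ H p s q β ε δ) (hH : IsGoodGrid μ H k₁ k₂) (hp : 1 ≤ p)
    (hq : 1 ≤ q) (hβ : 0 < β) {k : ℕ} {W : Set J} (hW : W ∈ H k) :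
    eLpNorm (D.absBlock m p s E c W) (ENNReal.ofReal p) μ ≤
      ENNReal.ofReal (μ.real W ^ s * (1 - k₂ ^ β)⁻¹) * D.totalCoef m μ p s E c W := by
  have hp' : 1 ≤ ENNReal.ofReal p := by simpa using hp
  refine (eLpNorm_tsum_le_ennreal (fun r => aemeasurable_tsum_ennreal fun j =>
    hE.aemeasurable_term hD hW r j) hp').trans ?_
  rw [totalCoef, ← ENNReal.tsum_mul_left]
  refine ENNReal.tsum_le_tsum fun r => (eLpNorm_tsum_le_ennreal (fun j =>
    hE.aemeasurable_term hD hW r j) hp').trans ?_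
  rw [← ENNReal.tsum_mul_left]
  exact ENNReal.tsum_le_tsum fun j => hE.eLpNorm_term_le hD hH hp hq hβ hW r j

theorem tsum_eLpNorm_absBlock_lt_top [IsProbabilityMeasure m]
    (hE : D.IsDecomposition m μ H p s ε γ E)
    (hD : D.IsAdmissible m P μ H p s q β ε δ) (hH : IsGoodGrid μ H k₁ k₂) (hp : 1 ≤ p)
    (hq : 1 ≤ q) (hs : 0 < s) (hβ : 0 < β)
    (hfin : coefNormE p q H (D.totalCoef m μ p s E c) < ∞) :
    ∑' k, eLpNorm (fun y => ∑ W ∈ H k, D.absBlock m p s E c W y) (ENNReal.ofReal p) μ < ∞ := by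
  have hG := hH.isDecayingGrid hs
  have hlev : ∀ k, eLpNorm (fun y => ∑ W ∈ H k, D.absBlock m p s E c W y) (ENNReal.ofReal p) μ ≤
      ENNReal.ofReal ((k₂ ^ s) ^ k) *
        (ENNReal.ofReal (1 - k₂ ^ β)⁻¹ * coefNormE p q H (D.totalCoef m μ p s E c)) := by
    intro k
    refine (eLpNorm_sum_le_of_disjoint hp (H k) (fun W hW => hE.aemeasurable_absBlock hD hW)
      fun y W hW W' hW' h h' => ?_).trans ?_
    · exact hH.eq_of_mem hW hW' (by_contra fun hy => h (absBlock_eq_zero hy))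
        (by_contra fun hy => h' (absBlock_eq_zero hy))
    · calc _ ≤ lpSum p (H k) (fun W => ENNReal.ofReal ((k₂ ^ s) ^ k) *
            (ENNReal.ofReal (1 - k₂ ^ β)⁻¹ * D.totalCoef m μ p s E c W)) := by
            refine lpSum_mono hp fun W hW =>
              (hE.eLpNorm_absBlock_le hD hH hp hq hβ hW).trans ?_
            rw [ENNReal.ofReal_mul (by positivity), mul_assoc]
            exact mul_le_mul_left (hG.size_le k W hW) _
        _ ≤ _ := by
            rw [lpSum_const_mul hp, lpSum_const_mul hp]
            gcongr
            exact lpSum_le_coefNormE hq _ k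
  refine (ENNReal.tsum_le_tsum hlev).trans_lt ?_
  rw [ENNReal.tsum_mul_right]
  exact ENNReal.mul_lt_top hG.tsum_lt_top (ENNReal.mul_lt_top ENNReal.ofReal_lt_top hfin)

/-- The pointwise expansion of `Φ_r(f)`. -/
theorem ae_branchOp_eq [IsProbabilityMeasure m] (hE : D.IsDecomposition m μ H p s ε γ E)
    (hD : D.IsAdmissible m P μ H p s q β ε δ) (hH : IsGoodGrid μ H k₁ k₂) (hp : 1 ≤ p)
    {f : I → ℂ} (r : D.Λ)
    (hc : IsSouzaRep m p q (D.localGrid r) s ((D.im r).indicator f) (c r)) :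
    ∀ᵐ y ∂μ, D.branchOp r f y = ∑' j, ∑' k, ∑ W ∈ H k,
      D.levelValue m p s E c r j W * potentialOn (D.g r) W y := by
  classical
  have hp' : 1 ≤ ENNReal.ofReal p := by simpa using hp
  have hmeas : ∀ j, AEStronglyMeasurable
      (fun x => ∑ Q ∈ D.localGrid r j, c r Q * souzaAtom m p s Q x) m := fun j =>
    (Finset.measurable_fun_sum _ fun Q hQ => (measurable_souzaAtom p s
      ((hD.branch r).localGrid.measurableSet j Q
        (mem_gridWithin.1 hQ).1)).const_mul _).aestronglyMeasurable
  have hae := (hD.branch r).ae_pullback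
    (ae_eq_tsum_of_tendsto hmeas hp' hc.abs_convergent hc.memLp.1 hc.tendsto)
  filter_upwards [hae] with y hy
  by_cases hyd : y ∈ D.dom r
  swap
  · have h0 : ∀ W, potentialOn (D.g r) W y = 0 := by
      intro W
      have : Function.extend Subtype.val (D.g r) 0 y = 0 :=
        Function.extend_apply' _ _ _ (by rintro ⟨⟨a, ha⟩, rfl⟩; exact hyd ha)
      simp [potentialOn, indicator, this]
    simp [branchOp, hyd, h0]
  have hg : Function.extend Subtype.val (D.g r) 0 y = D.g r ⟨y, hyd⟩ :=
    Subtype.val_injective.extend_apply (D.g r) 0 ⟨y, hyd⟩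
  have hbr : D.branchOp r f y = D.g r ⟨y, hyd⟩ * f (D.h r ⟨y, hyd⟩) := by simp [branchOp, hyd]
  have hf := hy hyd
  rw [indicator_of_mem (D.h r ⟨y, hyd⟩).2] at hf
  rw [hbr, hf, ← tsum_mul_left]
  refine tsum_congr fun j => ?_
  by_cases hex : ∃ Q ∈ D.localGrid r j, y ∈ D.pull r Q
  · obtain ⟨Q, hQ, hyQ⟩ := hex
    obtain ⟨W, hEW, hyW⟩ := hE.cover r j Q hQ y hyQ
    obtain ⟨k, hWk⟩ := (hE.mem r j Q hQ W hEW).1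
    -- For fixed j, the point h_r(y) lies in a single Q and y in a single W of its decomposition, so
    -- the sums over k and W have at most one nonzero term.
    have huniq : ∀ W', y ∈ W' → D.levelValue m p s E c r j W' ≠ 0 → W' = W := by
      intro W' hyW' hne
      obtain ⟨Q', hQ', hEW'⟩ := exists_of_levelValue_ne_zero hne
      obtain rfl := eq_of_mem_pull hD hQ' hQ ((hE.mem r j Q' hQ' W' hEW').2 hyW') hyQ
      exact hE.eq_of_mem r j Q' hQ' W' W hEW' hEW y hyW' hyW
    have hzero : ∀ W', W' ≠ W →
        D.levelValue m p s E c r j W' * potentialOn (D.g r) W' y = 0 := by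
      intro W' hne
      by_cases hyW' : y ∈ W'
      · rw [by_contra fun h => hne (huniq W' hyW' h), zero_mul]
      · simp [potentialOn, hyW']
    rw [tsum_eq_single k, Finset.sum_eq_single W (fun W' _ hne => hzero W' hne)
      (fun h => absurd hWk h), Finset.sum_eq_single Q]
    · have hval : D.levelValue m p s E c r j W =
          c r Q * ((m.real Q ^ (s - 1 / p) : ℝ) : ℂ) := by
        rw [levelValue, Finset.sum_eq_single Q]
        · simp [hEW]
        · intro Q' hQ' hne
          rw [if_neg fun h => hne (hE.unique hD hH hWk hQ' hQ h hEW)]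
        · exact fun h => absurd hQ h
      rw [hval, potentialOn, indicator_of_mem hyW, hg, souzaAtom,
        indicator_of_mem ((mem_pullback hyd).1 hyQ)]
      ring
    · intro Q' hQ' hne
      have hnot : ((D.h r ⟨y, hyd⟩ : D.im r) : I) ∉ Q' := fun h =>
        hne (eq_of_mem_pull hD hQ' hQ ((mem_pullback hyd).2 h) hyQ)
      simp [souzaAtom, hnot]
    · exact fun h => absurd hQ h
    · intro k' hk'
      refine Finset.sum_eq_zero fun W' hW' => hzero W' ?_
      rintro rfl
      exact hk' (hH.level_unique hW' hWk)
  · push Not at hex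
    rw [Finset.sum_eq_zero, mul_zero]
    · rw [tsum_congr (g := fun _ : ℕ => (0 : ℂ)), tsum_zero]
      intro k
      refine Finset.sum_eq_zero fun W hW => ?_
      by_cases hyW : y ∈ W
      · have : D.levelValue m p s E c r j W = 0 := by
          by_contra h
          obtain ⟨Q, hQ, hEW⟩ := exists_of_levelValue_ne_zero h
          exact hex Q hQ ((hE.mem r j Q hQ W hEW).2 hyW)
        rw [this, zero_mul]
      · simp [potentialOn, hyW]
    · intro Q hQ
      have hnot : ((D.h r ⟨y, hyd⟩ : D.im r) : I) ∉ Q := fun h =>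
        hex Q hQ ((mem_pullback hyd).2 h)
      simp [souzaAtom, hnot]

/-- Only a vanishing total coefficient needs an argument. All weights are strictly positive, so then
every c_Q whose decomposition contains W is zero, and the block vanishes as well. -/
theorem toReal_mul_blockAtom [IsProbabilityMeasure m]
    (hD : D.IsAdmissible m P μ H p s q β ε δ) (hH : IsGoodGrid μ H k₁ k₂) {k : ℕ} {W : Set J}
    (hW : W ∈ H k) (hfin : D.totalCoef m μ p s E c W ≠ ∞) (y : J) :
    (((D.totalCoef m μ p s E c W).toReal : ℝ) : ℂ) * D.blockAtom m μ p s E c W y =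
      D.block m p s E c W y := by
  classical
  rw [blockAtom]
  by_cases h0 : D.totalCoef m μ p s E c W = 0
  · have hval : ∀ r j, D.levelValue m p s E c r j W = 0 := by
      intro r j
      have h1 : D.levelCoef m μ p s E c r j W = 0 :=
        ENNReal.tsum_eq_zero.1 (ENNReal.tsum_eq_zero.1 h0 r) j
      rw [levelCoef, Finset.sum_eq_zero_iff] at h1
      refine Finset.sum_eq_zero fun Q hQ => ?_
      split_ifs with hEW
      · have h2 := h1 Q hQ
        obtain ⟨hQ1, hQ2⟩ := mem_gridWithin.1 hQ
        have hw : 0 < D.weight m μ p s r Q W := by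
          have h3 : 0 < m.real Q := (hD.branch r).real_pos hQ1
          have h4 : 0 < μ.real (D.pull r Q) := (hD.branch r).real_pullback_pos hQ1 hQ2
          have h5 := hH.real_pos hW
          have h6 := (hD.const_pos r).2.2.2.2
          unfold weight
          positivity
        rw [if_pos hEW, mul_eq_zero] at h2
        have h3 : c r Q = 0 := by
          rcases h2 with h | h
          · simpa using h
          · exact absurd (ENNReal.ofReal_eq_zero.1 h) (not_le.2 hw)
        rw [h3, zero_mul]
      · rfl
    simp [h0, block, hval]
  · rw [mul_inv_cancel_left₀]
    exact_mod_cast (ENNReal.toReal_pos h0 hfin).ne'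

/-- The expansion of `Φ(f)` by Besov atoms. -/
theorem isAtomicRep_transfer [IsProbabilityMeasure m] (hE : D.IsDecomposition m μ H p s ε γ E)
    (hD : D.IsAdmissible m P μ H p s q β ε δ) (hH : IsGoodGrid μ H k₁ k₂) (hp : 1 ≤ p)
    (hq : 1 ≤ q) (hs : 0 < s) (hβ : 0 < β) {f : I → ℂ}
    (hc : ∀ r, IsSouzaRep m p q (D.localGrid r) s ((D.im r).indicator f) (c r))
    (hfin : coefNormE p q H (D.totalCoef m μ p s E c) < ∞) :
    IsAtomicRep μ p q H (D.blockAtom m μ p s E c) (D.transfer f)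
      (fun W => (((D.totalCoef m μ p s E c W).toReal : ℝ) : ℂ)) := by
  have hp' : 1 ≤ ENNReal.ofReal p := by simpa using hp
  have hfinW : ∀ k, ∀ W ∈ H k, D.totalCoef m μ p s E c W ≠ ∞ := fun k W hW =>
    (((le_lpSum hp _ hW).trans (lpSum_le_coefNormE hq _ k)).trans_lt hfin).ne
  have hterm : ∀ k y, ∑ W ∈ H k, (((D.totalCoef m μ p s E c W).toReal : ℝ) : ℂ) *
      D.blockAtom m μ p s E c W y = ∑ W ∈ H k, D.block m p s E c W y := fun k y =>
    Finset.sum_congr rfl fun W hW => toReal_mul_blockAtom hD hH hW (hfinW k W hW) y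
  have hmeas : ∀ k, AEStronglyMeasurable (fun y => ∑ W ∈ H k,
      (((D.totalCoef m μ p s E c W).toReal : ℝ) : ℂ) * D.blockAtom m μ p s E c W y) μ := by
    refine fun k => Finset.aestronglyMeasurable_fun_sum _ fun W hW => ?_
    have hlt := (hE.isBesovAtom_blockAtom hD hH hp hq hβ hW (hfinW k W hW)).trans_lt
      ENNReal.ofReal_lt_top
    obtain ⟨d, hd, _⟩ := exists_isSouzaRep_of_besovNorm_lt hlt
    exact hd.memLp.1.const_mul _
  have habs := hE.tsum_eLpNorm_absBlock_lt_top hD hH hp hq hs hβ hfin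
  have hblock : ∀ W y, ‖D.block m p s E c W y‖ₑ ≤ D.absBlock m p s E c W y := by
    intro W y
    refine enorm_tsum_le_tsum_enorm.trans (ENNReal.tsum_le_tsum fun r => ?_)
    rw [enorm_mul, ENNReal.tsum_mul_right]
    gcongr
    exact enorm_tsum_le_tsum_enorm
  have hsum : ∑' k, eLpNorm (fun y => ∑ W ∈ H k,
      (((D.totalCoef m μ p s E c W).toReal : ℝ) : ℂ) * D.blockAtom m μ p s E c W y)
      (ENNReal.ofReal p) μ < ∞ := by
    refine lt_of_le_of_lt (ENNReal.tsum_le_tsum fun k => eLpNorm_mono_enorm fun y => ?_) habs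
    rw [hterm, enorm_eq_self]
    exact (enorm_sum_le _ _).trans (Finset.sum_le_sum fun W _ => hblock W y)
  have hmeasabs : ∀ k, AEMeasurable (fun y => ∑ W ∈ H k, D.absBlock m p s E c W y) μ :=
    fun k => Finset.aemeasurable_fun_sum _ fun W hW => hE.aemeasurable_absBlock hD hW
  -- Almost every point has an absolutely convergent full expansion; this is the hypothesis for
  -- rearranging the sums there.
  have hpt : ∀ᵐ y ∂μ, ∑' k, ∑ W ∈ H k, D.absBlock m p s E c W y < ∞ :=
    ae_lt_top_of_eLpNorm_lt_top (aemeasurable_tsum_ennreal hmeasabs) hp'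
      ((eLpNorm_tsum_le_ennreal hmeasabs hp').trans_lt habs)
  have hbr : ∀ᵐ y ∂μ, ∀ r, D.branchOp r f y = ∑' j, ∑' k, ∑ W ∈ H k,
      D.levelValue m p s E c r j W * potentialOn (D.g r) W y :=
    ae_all_iff.2 fun r => hE.ae_branchOp_eq hD hH hp r (hc r)
  have hae : D.transfer f =ᵐ[μ] fun y => ∑' k, ∑ W ∈ H k,
      (((D.totalCoef m μ p s E c W).toReal : ℝ) : ℂ) * D.blockAtom m μ p s E c W y := by
    filter_upwards [hpt, hbr] with y hy hbry
    rw [transfer, tsum_congr hbry, tsum_rearrange]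
    · refine tsum_congr fun k => ?_
      rw [hterm]
      refine Finset.sum_congr rfl fun W _ => tsum_congr fun r => ?_
      rw [tsum_mul_right]
    · simp only [enorm_mul]
      exact hy
  obtain ⟨h1, h2⟩ := memLp_tendsto_of_ae_eq_tsum hmeas hp' hsum hae
  refine ⟨h1, lt_of_le_of_lt ?_ hfin, hsum, h2⟩
  refine coefNormE_mono hp fun k W hW => ?_
  rw [← ofReal_norm, Complex.norm_real, Real.norm_of_nonneg ENNReal.toReal_nonneg]
  exact ENNReal.ofReal_toReal_le

end IsDecomposition

end TransferData

end BesovTransfer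

end

/-! ### Assembly of the two statements -/

theorem mainTheorem1 (p s β ε δ γ : ℝ) (q : ℝ≥0∞)
    (hp : 1 ≤ p) (hq : 1 ≤ q) (hs : 0 < s) (hε : 0 < ε) (hsε : s + ε ≤ 1 / p)
    (hsβ : s < β) (hβ : β < 1 / p) (hδ : 0 < δ) (hδ' : δ < max s ε)
    (hγ : 0 < γ) (hγ' : γ ≤ 1) :
    (∀ l₁ l₂ : ℝ, 0 < l₁ → l₁ < l₂ → l₂ < 1 →
      ∃ C_GBS : ℝ, 0 < C_GBS ∧
        ∀ (J : Type v) [MeasurableSpace J] (μ : Measure J) [IsProbabilityMeasure μ]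
          (H : ℕ → Finset (Set J)), IsGoodGrid μ H l₁ l₂ →
          IsBesovToSouzaConst μ p q H s β C_GBS) ∧
    (∀ (I : Type u) (J : Type v) [MeasurableSpace I] [MeasurableSpace J]
      (m : Measure I) (μ : Measure J) [IsProbabilityMeasure m] [IsProbabilityMeasure μ]
      (P : ℕ → Finset (Set I)) (H : ℕ → Finset (Set J)) (l₁ l₂ k₁ k₂ : ℝ),
      IsGoodGrid m P l₁ l₂ → IsGoodGrid μ H k₁ k₂ →
      ∀ C_GBS : ℝ, IsBesovToSouzaConst μ p q H s β C_GBS →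
      ∀ D : TransferData I J, D.IsAdmissible m P μ H p s q β ε δ →
      ∀ (f : I → ℂ) (d : Set I → ℂ) (C : ℝ),
        IsSouzaRep m p q P s f d →
        D.HasRegularSlicing m P H p s q ε γ f d C →
        MemBesov μ p q H s (D.transfer f) ∧
        ∃ z : Set J → ℂ, IsSouzaRep μ p q H s (D.transfer f) z ∧
          coefNorm p q H z ≤
            ENNReal.ofReal (C_GBS * (2 / (1 - D.supRate p ε ^ γ)) * C) * coefNorm p q P d ∧
          (D.HasPositivePotentials m μ H p s q β → NonnegCoef P d → NonnegCoef H z)) := by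
  have hβ0 : 0 < β := hs.trans hsβ
  refine ⟨fun l₁ l₂ h₁ h₁₂ h₂ => ⟨2 / (1 - l₂ ^ (β - s)) * 2, ?_, ?_⟩, ?_⟩
  · have : l₂ ^ (β - s) < 1 := Real.rpow_lt_one (h₁.trans h₁₂).le h₂ (by linarith)
    have : 0 < 1 - l₂ ^ (β - s) := by linarith
    positivity
  · intro J _ μ _ H hH
    exact isBesovToSouzaConst hH hp hq hs hsβ
  intro I J _ _ m μ _ _ P H l₁ l₂ k₁ k₂ _ hH C_GBS hC D hD f d C hfd ⟨hC0, _, c, hc, hcn, hc0⟩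
  obtain ⟨E, hE⟩ := hD.exists_isDecomposition hH hp hε hγ hγ'
  have hx : 0 ≤ 2 / (1 - D.supRate p ε ^ γ) := by
    have := Real.rpow_lt_one hD.supRate_nonneg hD.supRate_lt_one hγ
    exact div_nonneg two_pos.le (by linarith)
  have hbound : coefNormE p q H (D.totalCoef m μ p s E c) ≤
      ENNReal.ofReal (2 / (1 - D.supRate p ε ^ γ)) * (ENNReal.ofReal C * coefNorm p q P d) := by
    rcases hcn with h | h
    · exact (hE.coefNormE_totalCoef_le₁ hD hH hp hq hγ).trans (by gcongr)
    · exact (hE.coefNormE_totalCoef_le₂ hD hH hp hq hγ).trans (by gcongr)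
  have hfin := hbound.trans_lt (ENNReal.mul_lt_top ENNReal.ofReal_lt_top
    (ENNReal.mul_lt_top ENNReal.ofReal_lt_top hfd.coefNorm_lt_top))
  have hfinW : ∀ k, ∀ W ∈ H k, D.totalCoef m μ p s E c W ≠ ∞ := fun k W hW =>
    (((le_lpSum hp _ hW).trans (lpSum_le_coefNormE hq _ k)).trans_lt hfin).ne
  have hrep := hE.isAtomicRep_transfer hD hH hp hq hs hβ0 hc hfin
  obtain ⟨z, hz, hzn, hz0⟩ := hC _ _ _
    (fun k W hW => hE.isBesovAtom_blockAtom hD hH hp hq hβ0 hW (hfinW k W hW)) hrep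
  refine ⟨⟨z, hz⟩, z, hz, hzn.trans ?_, fun hpos hd => hz0 ?_ fun k W hW =>
    hE.isPositiveBesovAtom_blockAtom hD hH hp hq hβ0 hW (hfinW k W hW) hpos (hc0 hd)⟩
  -- The product splits using only the signs of C and 2/(1-λ^γ), so no sign of `C_GBS` is needed.
  · rw [ENNReal.ofReal_mul' hC0, ENNReal.ofReal_mul' hx, mul_assoc, mul_assoc]
    gcongr
    refine le_trans (coefNormE_mono hp fun k W hW => ?_) hbound
    rw [← ofReal_norm, Complex.norm_real, Real.norm_of_nonneg ENNReal.toReal_nonneg]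
    exact ENNReal.ofReal_toReal_le
  · intro k W _
    change (0 : ℂ) ≤ (((D.totalCoef m μ p s E c W).toReal : ℝ) : ℂ)
    exact_mod_cast ENNReal.toReal_nonneg
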